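/- Let $d\ge 1$ and $\alpha\in(1,2)$. Let $\nu_\alpha$ be an $\alpha$-stable Lévy measure on $\mathbb{R}^d$, i.e. a positive Borel measure with $\nu_\alpha(\{0\})=0$, $\int_{\mathbb{R}^d}(1\wedge\|u\|^2)\,\nu_\alpha(du)<+\infty$ and $c^{-\alpha}\nu_\alpha(B/c)=\nu_\alpha(B)$ for all $c>0$ and all Borel sets $B$. It has the polar decomposition $\nu_\alpha(du)=\mathbb{1}_{(0,+\infty)}(r)\,\mathbb{1}_{\mathbb{S}^{d-1}}(y)\,\frac{dr}{r^{\alpha+1}}\,\sigma(dy)$ with $u=ry$ and $\sigma$ a finite positive measure on the unit sphere $\mathbb{S}^{d-1}$. Assume that $\sigma$ is symmetric, $\sigma(B)=\sigma(-B)$, let $$\lambda_1=-\cos\Big(\frac{\alpha\pi}{2}\Big)\frac{\Gamma(2-\alpha)}{\alpha(\alpha-1)}\,\sigma$$ be the spectral measure, and assume that $\nu_\alpha$ is non-degenerate: $\inf_{y\in\mathbb{S}^{d-1}}\int_{\mathbb{S}^{d-1}}|\langle y;x\rangle|^\alpha\lambda_1(dx)>0$. Let $\mu_\alpha$ be the associated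 $\alpha$-stable probability measure on $\mathbb{R}^d$, that is, $$\int_{\mathbb{R}^d} e^{i\langle y;\xi\rangle}\mu_\alpha(dy)=\exp\Big(\int_{\mathbb{R}^d}\big(e^{i\langle u;\xi\rangle}-1-i\langle \xi;u\rangle\big)\nu_\alpha(du)\Big),\qquad \xi\in\mathbb{R}^d,$$ and let $p_\alpha$ be the continuous version of its Lebesgue density (which is smooth and positive). For $f\in\mathcal{C}_c^\infty(\mathbb{R}^d)$ (real-valued), $t>0$ and $x,\xi\in\mathbb{R}^d$, put $$P_t^\alpha f(x)=\int_{\mathbb{R}^d} f(x+t^{1/\alpha}y)\,\mu_\alpha(dy),\qquad D^{\alpha-1}f(x)=\int_{\mathbb{R}^d}(f(x+u)-f(x))\,u\,\nu_\alpha(du),$$ $$\sigma_\alpha(\xi)=\Big(\int_{\mathbb{S}^{d-1}}|\langle y;\xi\rangle|^\alpha\lambda_1(dy)\Big)^{1/\alpha}.$$ Assume that, for all $p\in[1,+\infty)$, $\big\|\frac{\nabla p_\alpha}{p_\alpha}\big\|_{L^p(\mu_\alpha)}<+\infty$. Then, for all $p\in[1,+\infty)$, all $t>0$ and all $f\in\mathcal{C}_c^\infty(\mathbb{R}^d)$,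 $$\|P_t^\alpha f-f\|_{L^p(\mathbb{R}^d,dx)}\le \frac{t^{1-\frac1\alpha}}{\alpha-1}\,\Big\|\frac{\nabla p_\alpha}{p_\alpha}\Big\|_{L^p(\mu_\alpha)}\,\|D^{\alpha-1}f\|_{L^p(\mathbb{R}^d,dx)}.$$ Moreover, for all $p\in[1,\alpha)$, all $t>0$ and all $f\in\mathcal{C}_c^\infty(\mathbb{R}^d)$, $$\|P_t^\alpha f-f\|_{L^p(\mathbb{R}^d,dx)}\le t^{\frac1\alpha}\,\big(\mathbb{E}|Y_\alpha|^p\big)^{\frac1p}\,\|\sigma_\alpha(\nabla f)\|_{L^p(\mathbb{R}^d,dx)},$$ where $Y_\alpha$ is a real random variable with $\mathbb{E}\,e^{i\xi Y_\alpha}=e^{-|\xi|^\alpha}$ for all $\xi\in\mathbb{R}$. -/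

import Mathlib

open MeasureTheory
open scoped ContDiff RealInnerProductSpace

noncomputable section

namespace StableHeat

/-- The Euclidean space of dimension `d`. -/
abbrev Rd (d : ℕ) : Type := EuclideanSpace ℝ (Fin d)

variable {d : ℕ}

/-- `ν` is an `α`-stable Lévy measure: it does not charge the origin, it integrates
`1 ∧ ‖u‖²`, and `c ^ (-α) * ν (B / c) = ν B` for all `c > 0` and all Borel sets `B`. -/
structure IsStableLevyMeasure (α : ℝ) (ν : Measure (Rd d)) : Prop where
  zero : ν {0} = 0
  lintegral_lt_top : ∫⁻ u, ENNReal.ofReal (min 1 (‖u‖ ^ 2)) ∂ν < ⊤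
  scale : ∀ c : ℝ, 0 < c → ENNReal.ofReal (c ^ (-α)) • ν.map (fun u => c • u) = ν

/-- The spherical component `σ` of an `α`-stable Lévy measure `ν`, seen as a Borel measure on the
whole space which is carried by the unit sphere:
`σ B = α * ν {u | 1 ≤ ‖u‖ and u / ‖u‖ ∈ B}`.
This is the measure `σ` of the polar decomposition `ν(du) = r ^ (-α-1) dr σ(dy)`, `u = r y`,
see `sphericalPart_polar`. -/
def sphericalPart (α : ℝ) (ν : Measure (Rd d)) : Measure (Rd d) :=
  ENNReal.ofReal α • (ν.restrict {u | 1 ≤ ‖u‖}).map (fun u => ‖u‖⁻¹ • u)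

/-- The measure with polar decomposition `r ^ (-α-1) dr σ(dy)` on `(0, ∞) × sphere`. -/
def polarMeasure (α : ℝ) (σ : Measure (Rd d)) : Measure (Rd d) :=
  (σ.prod ((volume.restrict (Set.Ioi (0 : ℝ))).withDensity
    (fun r => ENNReal.ofReal (r ^ (-α - 1))))).map (fun z => z.2 • z.1)

/-- `sphericalPart` recovers the spherical component from the polar decomposition. -/
theorem sphericalPart_polar {α : ℝ} (hα : 0 < α) (σ : Measure (Rd d)) [IsFiniteMeasure σ]
    (hσ : σ (Metric.sphere 0 1)ᶜ = 0) :
    sphericalPart α (polarMeasure α σ) = σ := by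
  set ρ : Measure ℝ := (volume.restrict (Set.Ioi (0 : ℝ))).withDensity
    (fun r => ENNReal.ofReal (r ^ (-α - 1))) with hρ
  have hρ1 : ρ (Set.Ici 1) = ENNReal.ofReal (1 / α) := by
    rw [hρ, withDensity_apply _ measurableSet_Ici, Measure.restrict_restrict measurableSet_Ici,
      show Set.Ici (1 : ℝ) ∩ Set.Ioi 0 = Set.Ici 1 from
        Set.inter_eq_left.2 (fun x hx => lt_of_lt_of_le (one_pos : (0 : ℝ) < 1) hx),
      ← restrict_Ioi_eq_restrict_Ici,
      ← ofReal_integral_eq_lintegral_ofReal (integrableOn_Ioi_rpow_of_lt (by linarith) one_pos),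
      integral_Ioi_rpow_of_lt (by linarith) one_pos]
    · congr 1
      rw [Real.one_rpow]
      have : -α - 1 + 1 = -α := by ring
      rw [this, neg_div_neg_eq]
    · filter_upwards [ae_restrict_mem measurableSet_Ioi] with x hx
      exact Real.rpow_nonneg (le_of_lt (lt_trans one_pos hx)) _
  have hρ0 : ρ (Set.Iic 0) = 0 := by
    rw [hρ, withDensity_apply _ measurableSet_Iic, Measure.restrict_restrict measurableSet_Iic]
    rw [Set.Iic_inter_Ioi, Set.Ioc_self, Measure.restrict_empty, lintegral_zero_measure]
  have hm : Measurable (fun u : Rd d => ‖u‖⁻¹ • u) := by fun_prop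
  have hm' : Measurable (fun z : Rd d × ℝ => z.2 • z.1) := by fun_prop
  have hS : MeasurableSet {u : Rd d | 1 ≤ ‖u‖} := measurableSet_le measurable_const (by fun_prop)
  ext B hB
  rw [sphericalPart, Measure.smul_apply, Measure.map_apply hm hB,
    Measure.restrict_apply (hm hB), polarMeasure, Measure.map_apply hm' ((hm hB).inter hS)]
  have hae : (fun z : Rd d × ℝ => z.2 • z.1) ⁻¹'
      ((fun u : Rd d => ‖u‖⁻¹ • u) ⁻¹' B ∩ {u : Rd d | 1 ≤ ‖u‖})
      =ᵐ[σ.prod ρ] B ×ˢ Set.Ici (1 : ℝ) := by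
    have h1 : ∀ᵐ z ∂(σ.prod ρ), z.1 ∈ Metric.sphere (0 : Rd d) 1 :=
      Measure.quasiMeasurePreserving_fst.ae (p := fun y => y ∈ Metric.sphere (0 : Rd d) 1)
        (by rw [ae_iff]; exact hσ)
    have h2 : ∀ᵐ z ∂(σ.prod ρ), z.2 ∈ Set.Ioi (0 : ℝ) :=
      Measure.quasiMeasurePreserving_snd.ae (p := fun r => r ∈ Set.Ioi (0 : ℝ))
        (by rw [ae_iff]; convert hρ0 using 2; ext; simp)
    filter_upwards [h1, h2] with z hz1 hz2
    have hz1' : ‖z.1‖ = 1 := by simpa using hz1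
    have hz2' : 0 < z.2 := hz2
    apply propext
    change (‖z.2 • z.1‖⁻¹ • z.2 • z.1 ∈ B ∧ 1 ≤ ‖z.2 • z.1‖) ↔ (z.1 ∈ B ∧ 1 ≤ z.2)
    rw [norm_smul, hz1', Real.norm_of_nonneg hz2'.le, mul_one, smul_smul,
      inv_mul_cancel₀ hz2'.ne', one_smul]
  rw [measure_congr hae, Measure.prod_prod, hρ1, smul_eq_mul, mul_comm (σ B), ← mul_assoc,
    ← ENNReal.ofReal_mul hα.le, mul_one_div_cancel hα.ne', ENNReal.ofReal_one, one_mul]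

/-- The spectral measure `λ₁ = - cos (α π / 2) Γ(2 - α) / (α (α - 1)) σ`. -/
def spectralMeasure (α : ℝ) (ν : Measure (Rd d)) : Measure (Rd d) :=
  ENNReal.ofReal (-Real.cos (α * (Real.pi / 2)) * (Real.Gamma (2 - α) / (α * (α - 1)))) •
    sphericalPart α ν

/-- `ν` is a non-degenerate symmetric `α`-stable Lévy measure. -/
structure IsNondegenerateSymmetricStable (α : ℝ) (ν : Measure (Rd d)) : Prop
    extends IsStableLevyMeasure α ν where
  symm : (sphericalPart α ν).map (fun y => -y) = sphericalPart α ν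
  nondegenerate :
    0 < ⨅ y : Metric.sphere (0 : Rd d) 1, ∫ x, |⟪(y : Rd d), x⟫| ^ α ∂(spectralMeasure α ν)

/-- `μ` is the stable probability measure associated with the Lévy measure `ν`. -/
structure IsStableLaw (ν μ : Measure (Rd d)) : Prop where
  isProbabilityMeasure : IsProbabilityMeasure μ
  fourier : ∀ ξ : Rd d,
    ∫ y, Complex.exp (Complex.I * (⟪y, ξ⟫ : ℝ)) ∂μ =
      Complex.exp (∫ u, (Complex.exp (Complex.I * (⟪u, ξ⟫ : ℝ)) - 1
        - Complex.I * (⟪ξ, u⟫ : ℝ)) ∂ν)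

/-- `p` is the Lebesgue density of `μ`, in its continuous version. It is only asked to be
nonnegative: that the density of a non-degenerate stable law is smooth and positive everywhere
is a fact about it, which is not assumed. -/
structure IsLebesgueDensity (μ : Measure (Rd d)) (p : Rd d → ℝ) : Prop where
  continuous : Continuous p
  nonneg : ∀ x, 0 ≤ p x
  eq_withDensity : μ = volume.withDensity (fun x => ENNReal.ofReal (p x))

/-- The logarithmic derivative `∇p / p`. -/
def logDerivative (p : Rd d → ℝ) (x : Rd d) : Rd d := (p x)⁻¹ • gradient p x

/-- The function `σ_α(ξ) = (∫ |⟨y, ξ⟩| ^ α λ₁(dy)) ^ (1 / α)`. -/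
def sigmaNorm (α : ℝ) (ν : Measure (Rd d)) (ξ : Rd d) : ℝ :=
  (∫ y, |⟪y, ξ⟫| ^ α ∂(spectralMeasure α ν)) ^ (1 / α)

/-- The stable heat semigroup `P_t f(x) = ∫ f(x + t ^ (1 / α) y) μ(dy)`. -/
def stableSemigroup (α : ℝ) (μ : Measure (Rd d)) (t : ℝ) (f : Rd d → ℝ) (x : Rd d) : ℝ :=
  ∫ y, f (x + t ^ (1 / α) • y) ∂μ

/-- The fractional gradient `D^{α-1} f(x) = ∫ (f(x + u) - f(x)) u ν(du)`. -/
def fracGradient (ν : Measure (Rd d)) (f : Rd d → ℝ) (x : Rd d) : Rd d :=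
  ∫ u, (f (x + u) - f x) • u ∂ν

end StableHeat

end

/-! Write ψ(ξ) = ∫ |⟨y, ξ⟩|^α λ₁(dy) (`stableExponent`). By symmetry the Lévy-Khintchine exponent
equals -∫ (1 - cos⟨u, ξ⟩) ν(du). The polar decomposition, itself a consequence of the scaling of ν,
together with the value of ∫ (1 - cos r) r^(-α-1) dr, identifies it as -ψ(ξ). So μ has
characteristic function exp(-ψ), with ψ homogeneous of degree α.

First estimate. On the Fourier side f - P_t f has multiplier 1 - exp(-tψ) = ∫_0^t ψ exp(-sψ) ds.
Pairing the symbol ∫ (e^{i⟨u,ξ⟩} - 1) u ν(du) of D^{α-1} with iξ gives -αψ(ξ), which is Euler's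
identity for ψ (`integral_mul_cexp_sub_one`). An integration by parts against p_α makes the factor
iξ appear, and so f - P_t f = ∫_0^t s^(-1/α)/α ∫ ⟨D^{α-1}f(x + s^(1/α) y), ∇p_α(y)⟩ dy ds. Since
∇p_α = p_α (∇p_α/p_α), this is an average of translates of D^{α-1}f against μ and s^(-1/α)/α ds, of
total mass t^(1-1/α)/(α-1). Jensen's inequality and translation invariance conclude.

Second estimate. By Jensen and the mean value formula, the L^p norm of P_t f - f is controlled by
the moments of ⟨y, ∇f(x)⟩ under μ, and this variable has the law of σ_α(∇f(x)) Y_α (`map_inner_eq`).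
-/

namespace StableHeat

variable {d : ℕ} {α : ℝ} {ν μ : Measure (Rd d)} {pα : Rd d → ℝ} {f : Rd d → ℝ}

/-! ### Polar decomposition of a stable Lévy measure -/

theorem lintegral_Ioi_eq_mul_lintegral_comp_mul {a : ℝ} (ha : 0 < a) (G : ℝ → ENNReal) :
    ∫⁻ r in Set.Ioi (0 : ℝ), G r =
      ENNReal.ofReal a * ∫⁻ s in Set.Ioi (0 : ℝ), G (a * s) := by
  have himg : (fun s : ℝ => a * s) '' Set.Ioi 0 = Set.Ioi 0 := by
    simp [Set.image_mul_left_Ioi ha]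
  have h := lintegral_image_eq_lintegral_abs_deriv_mul (s := Set.Ioi (0 : ℝ))
    (f := fun s => a * s) (f' := fun _ => a) measurableSet_Ioi
    (fun x _ => by simpa using ((hasDerivAt_id x).const_mul a).hasDerivWithinAt)
    (mul_right_injective₀ ha.ne').injOn G
  rw [himg] at h
  rw [h, abs_of_pos ha, lintegral_const_mul' _ _ ENNReal.ofReal_ne_top]

theorem IsStableLevyMeasure.ae_ne_zero (hν : IsStableLevyMeasure α ν) : ∀ᵐ u ∂ν, u ≠ 0 := by
  rw [ae_iff]
  simpa using hν.zero

theorem IsStableLevyMeasure.lintegral_comp_smul (hν : IsStableLevyMeasure α ν) {c : ℝ}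
    (hc : 0 < c) {F : Rd d → ENNReal} (hF : Measurable F) :
    ∫⁻ u, F (c • u) ∂ν = ENNReal.ofReal (c ^ α) * ∫⁻ u, F u ∂ν := by
  conv_rhs => rw [← hν.scale c hc]
  rw [lintegral_smul_measure, lintegral_map hF (by fun_prop), smul_eq_mul, ← mul_assoc,
    ← ENNReal.ofReal_mul (by positivity), ← Real.rpow_add hc]
  simp

/-- The weight 1 ∧ ‖u‖² makes ν finite and vanishes only at the origin, a ν-null point, so dividing
by it recovers ν. This is what permits Tonelli with ν. -/
theorem IsStableLevyMeasure.sFinite (hν : IsStableLevyMeasure α ν) : SFinite ν := by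
  set g : Rd d → ENNReal := fun u => ENNReal.ofReal (min 1 (‖u‖ ^ 2)) with hg
  have hgm : Measurable g := by fun_prop
  have : IsFiniteMeasure (ν.withDensity g) := isFiniteMeasure_withDensity hν.lintegral_lt_top.ne
  have h : (ν.withDensity g).withDensity (fun u => (g u)⁻¹) = ν := by
    refine withDensity_inv_same hgm ?_ ?_
    · filter_upwards [hν.ae_ne_zero] with u hu
      have : 0 < ‖u‖ := norm_pos_iff.2 hu
      simp only [hg, ne_eq, ENNReal.ofReal_eq_zero, not_le]
      positivity
    · exact Filter.Eventually.of_forall fun u => ENNReal.ofReal_ne_top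
  rw [← h]
  infer_instance

theorem IsStableLevyMeasure.measure_one_le_norm (hν : IsStableLevyMeasure α ν) :
    ν {u | 1 ≤ ‖u‖} < ⊤ := by
  have hS : MeasurableSet {u : Rd d | 1 ≤ ‖u‖} := measurableSet_le measurable_const (by fun_prop)
  refine lt_of_le_of_lt ?_ hν.lintegral_lt_top
  rw [← setLIntegral_one]
  refine (setLIntegral_mono' hS fun u hu => ?_).trans (setLIntegral_le_lintegral _ _)
  have hu' : 1 ≤ ‖u‖ := hu
  rw [min_eq_left (by nlinarith)]
  simp

theorem IsStableLevyMeasure.isFiniteMeasure_sphericalPart (hν : IsStableLevyMeasure α ν) :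
    IsFiniteMeasure (sphericalPart α ν) := by
  have : IsFiniteMeasure (ν.restrict {u | 1 ≤ ‖u‖}) :=
    isFiniteMeasure_restrict.2 hν.measure_one_le_norm.ne
  unfold sphericalPart
  exact Measure.smul_finite _ ENNReal.ofReal_ne_top

theorem ae_norm_eq_one_sphericalPart : ∀ᵐ y ∂(sphericalPart α ν), ‖y‖ = 1 := by
  have hS : MeasurableSet {u : Rd d | 1 ≤ ‖u‖} := measurableSet_le measurable_const (by fun_prop)
  refine Measure.ae_smul_measure ?_ _
  rw [ae_map_iff (by fun_prop) (measurableSet_eq_fun (by fun_prop) measurable_const)]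
  filter_upwards [ae_restrict_mem hS] with u hu
  have hu' : 1 ≤ ‖u‖ := hu
  rw [norm_smul, norm_inv, norm_norm, inv_mul_cancel₀ (by positivity)]

theorem lintegral_Ioi_indicator_rpow (hα : 0 < α) {a : ℝ} (ha : 0 < a) :
    ∫⁻ s in Set.Ioi (0 : ℝ), (Set.Iic a).indicator
      (fun s => ENNReal.ofReal (α * s ^ (α - 1))) s = ENNReal.ofReal (a ^ α) := by
  rw [lintegral_indicator measurableSet_Iic, Measure.restrict_restrict measurableSet_Iic,
    Set.inter_comm, Set.Ioi_inter_Iic, ← ofReal_integral_eq_lintegral_ofReal]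
  · rw [← intervalIntegral.integral_of_le ha.le, intervalIntegral.integral_const_mul,
      integral_rpow (Or.inl (by linarith))]
    congr 1
    rw [sub_add_cancel, Real.zero_rpow hα.ne']
    field_simp
    ring
  · have := (intervalIntegral.intervalIntegrable_rpow' (r := α - 1) (a := 0) (b := a)
      (by linarith)).const_mul α
    rwa [intervalIntegrable_iff_integrableOn_Ioc_of_le ha.le] at this
  · filter_upwards [ae_restrict_mem measurableSet_Ioc] with s hs
    have : 0 < s := hs.1
    positivity

/-- Only scaling is used. With r = s‖u‖ the right side is an integral over ‖u‖ ≥ 1 of α‖u‖^(-α)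
F(su) s^(-α-1). After Tonelli, the change v = su for fixed s moves all the dependence on s into α
s^(α-1) on s ≤ ‖v‖, whose integral ‖v‖^α cancels the remaining ‖v‖^(-α). -/
theorem IsStableLevyMeasure.lintegral_polar (hν : IsStableLevyMeasure α ν) (hα : 0 < α)
    {F : Rd d → ENNReal} (hF : Measurable F) :
    ∫⁻ u, F u ∂ν = ∫⁻ y, (∫⁻ r in Set.Ioi (0 : ℝ), F (r • y) * ENNReal.ofReal (r ^ (-α - 1)))
      ∂(sphericalPart α ν) := by
  have := hν.sFinite
  have hS : MeasurableSet {u : Rd d | 1 ≤ ‖u‖} := measurableSet_le measurable_const (by fun_prop)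
  have hFm : Measurable fun z : Rd d × ℝ => F (z.2 • z.1) * ENNReal.ofReal (z.2 ^ (-α - 1)) := by
    have : Measurable fun z : Rd d × ℝ => z.2 • z.1 := by fun_prop
    exact (hF.comp this).mul (by fun_prop)
  set w : Rd d → ENNReal := {u : Rd d | 1 ≤ ‖u‖}.indicator
    (fun u => ENNReal.ofReal (α * ‖u‖ ^ (-α))) with hw
  have hwm : Measurable w := Measurable.indicator (by fun_prop) hS
  have step1 : ∫⁻ y, (∫⁻ r in Set.Ioi (0 : ℝ), F (r • y) * ENNReal.ofReal (r ^ (-α - 1)))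
      ∂(sphericalPart α ν) = ∫⁻ u, (∫⁻ s in Set.Ioi (0 : ℝ),
        F (s • u) * w u * ENNReal.ofReal (s ^ (-α - 1))) ∂ν := by
    rw [sphericalPart, lintegral_smul_measure, lintegral_map hFm.lintegral_prod_right'
      (by fun_prop), smul_eq_mul, ← lintegral_const_mul' _ _ ENNReal.ofReal_ne_top,
      ← lintegral_indicator hS]
    refine lintegral_congr fun u => ?_
    by_cases hu : 1 ≤ ‖u‖
    · have hu0 : 0 < ‖u‖ := by linarith
      rw [Set.indicator_of_mem (by exact hu), lintegral_Ioi_eq_mul_lintegral_comp_mul hu0,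
        ← mul_assoc, ← ENNReal.ofReal_mul hα.le,
        ← lintegral_const_mul' _ _ ENNReal.ofReal_ne_top]
      refine setLIntegral_congr_fun measurableSet_Ioi fun s hs => ?_
      have hs0 : 0 < s := hs
      simp only [hw]
      rw [Set.indicator_of_mem (by exact hu), smul_smul, mul_assoc (F _),
        ← ENNReal.ofReal_mul (by positivity), mul_left_comm, ← ENNReal.ofReal_mul (by positivity)]
      congr 2
      · congr 2
        field_simp
      · rw [Real.mul_rpow hu0.le hs0.le, Real.rpow_sub_one hu0.ne']
        field_simp
    · rw [Set.indicator_of_notMem (by exact hu)]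
      simp only [hw]
      rw [Set.indicator_of_notMem (by exact hu)]
      simp
  have hGm : Measurable fun z : Rd d × ℝ =>
      F (z.2 • z.1) * w z.1 * ENNReal.ofReal (z.2 ^ (-α - 1)) := by
    have : Measurable fun z : Rd d × ℝ => z.2 • z.1 := by fun_prop
    exact ((hF.comp this).mul (hwm.comp measurable_fst)).mul (by fun_prop)
  rw [step1, lintegral_lintegral_swap hGm.aemeasurable]
  have step2 : ∀ s ∈ Set.Ioi (0 : ℝ),
      ∫⁻ u, F (s • u) * w u * ENNReal.ofReal (s ^ (-α - 1)) ∂ν =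
      ∫⁻ v, F v * ENNReal.ofReal (‖v‖ ^ (-α)) * (Set.Iic ‖v‖).indicator
        (fun s => ENNReal.ofReal (α * s ^ (α - 1))) s ∂ν := by
    intro s hs
    have hs0 : 0 < s := hs
    have hH : Measurable fun v : Rd d =>
        F v * w (s⁻¹ • v) * ENNReal.ofReal (s ^ (-α - 1)) :=
      (hF.mul (hwm.comp (by fun_prop))).mul measurable_const
    have h := hν.lintegral_comp_smul hs0 hH
    simp only [smul_smul, inv_mul_cancel₀ hs0.ne', one_smul] at h
    rw [h, ← lintegral_const_mul' _ _ ENNReal.ofReal_ne_top]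
    refine lintegral_congr fun v => ?_
    have hiff : (s⁻¹ • v ∈ {u : Rd d | 1 ≤ ‖u‖}) ↔ s ∈ Set.Iic ‖v‖ := by
      simp only [Set.mem_ofPred_eq, norm_smul, norm_inv, Real.norm_of_nonneg hs0.le, Set.mem_Iic]
      rw [inv_mul_eq_div, one_le_div hs0]
    by_cases hv : s ∈ Set.Iic ‖v‖
    · have hv0 : 0 < ‖v‖ := lt_of_lt_of_le hs0 hv
      simp only [hw]
      rw [Set.indicator_of_mem (hiff.2 hv), Set.indicator_of_mem hv, mul_assoc, mul_assoc,
        mul_left_comm, ← ENNReal.ofReal_mul (by positivity), ← ENNReal.ofReal_mul (by positivity),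
        ← ENNReal.ofReal_mul (by positivity)]
      congr 2
      rw [norm_smul, norm_inv, Real.norm_of_nonneg hs0.le, Real.mul_rpow (by positivity) hv0.le,
        Real.inv_rpow hs0.le, Real.rpow_neg hs0.le, Real.rpow_sub_one hs0.ne',
        Real.rpow_neg hs0.le, Real.rpow_sub_one hs0.ne']
      field_simp
    · simp only [hw]
      rw [Set.indicator_of_notMem (fun h => hv (hiff.1 h)), Set.indicator_of_notMem hv]
      simp
  rw [setLIntegral_congr_fun measurableSet_Ioi step2, lintegral_lintegral_swap]
  · refine lintegral_congr_ae ?_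
    filter_upwards [hν.ae_ne_zero] with v hv
    have hv0 : 0 < ‖v‖ := norm_pos_iff.2 hv
    rw [lintegral_const_mul _ (Measurable.indicator (by fun_prop) measurableSet_Iic),
      lintegral_Ioi_indicator_rpow hα hv0, mul_assoc, ← ENNReal.ofReal_mul (by positivity),
      ← Real.rpow_add hv0]
    simp
  · have hT : MeasurableSet {z : ℝ × Rd d | z.1 ≤ ‖z.2‖} :=
      measurableSet_le measurable_fst (by fun_prop)
    have h1 : Measurable ({z : ℝ × Rd d | z.1 ≤ ‖z.2‖}.indicator
        fun z => ENNReal.ofReal (α * z.1 ^ (α - 1))) := Measurable.indicator (by fun_prop) hT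
    exact (((hF.comp measurable_snd).mul (by fun_prop)).mul h1).aemeasurable

theorem lintegral_Ioi_min_sq_mul_rpow_lt_top (hα : α ∈ Set.Ioo (1 : ℝ) 2) :
    ∫⁻ r in Set.Ioi (0 : ℝ), ENNReal.ofReal (min r (r ^ 2) * r ^ (-α - 1)) < ⊤ := by
  obtain ⟨h1, h2⟩ := hα
  have hm : MeasurableSet (Set.Ioc (0 : ℝ) 1) := measurableSet_Ioc
  have key : IntegrableOn (fun r : ℝ => min r (r ^ 2) * r ^ (-α - 1)) (Set.Ioi 0) := by
    rw [← Set.Ioc_union_Ioi_eq_Ioi (zero_le_one' ℝ), integrableOn_union]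
    constructor
    · have h := intervalIntegral.intervalIntegrable_rpow' (r := 1 - α) (a := 0) (b := 1)
        (by linarith)
      rw [intervalIntegrable_iff_integrableOn_Ioc_of_le zero_le_one] at h
      refine h.congr_fun (fun r hr => ?_) hm
      have hr0 : 0 < r := hr.1
      simp only
      rw [min_eq_right (by nlinarith [hr.2]), ← Real.rpow_natCast, ← Real.rpow_add hr0]
      congr 1
      push_cast
      ring
    · refine (integrableOn_Ioi_rpow_of_lt (a := -α) (by linarith) one_pos).congr_fun
        (fun r hr => ?_) measurableSet_Ioi
      have hr1 : 1 < r := hr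
      have hr0 : 0 < r := by linarith
      simp only
      rw [min_eq_left (by nlinarith), Real.rpow_sub_one hr0.ne']
      field_simp
  exact key.lintegral_lt_top

/-- The Lévy condition only controls 1 ∧ ‖u‖². The gain of a first moment at infinity comes from α >
1 in polar coordinates. This bound is what dominates both the compensated exponentials and the
integrand of D^{α-1}. -/
theorem IsStableLevyMeasure.integrable_min_norm (hν : IsStableLevyMeasure α ν)
    (hα : α ∈ Set.Ioo (1 : ℝ) 2) : Integrable (fun u : Rd d => min ‖u‖ (‖u‖ ^ 2)) ν := by
  have := hν.isFiniteMeasure_sphericalPart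
  refine ⟨by fun_prop, ?_⟩
  rw [hasFiniteIntegral_iff_ofReal (Filter.Eventually.of_forall fun u => by positivity),
    hν.lintegral_polar (by linarith [hα.1]) (by fun_prop)]
  have h : ∀ᵐ y ∂(sphericalPart α ν), (∫⁻ r in Set.Ioi (0 : ℝ),
      ENNReal.ofReal (min ‖r • y‖ (‖r • y‖ ^ 2)) * ENNReal.ofReal (r ^ (-α - 1))) =
      ∫⁻ r in Set.Ioi (0 : ℝ), ENNReal.ofReal (min r (r ^ 2) * r ^ (-α - 1)) := by
    filter_upwards [ae_norm_eq_one_sphericalPart] with y hy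
    refine setLIntegral_congr_fun measurableSet_Ioi fun r hr => ?_
    have hr0 : 0 < r := hr
    rw [norm_smul, hy, mul_one, Real.norm_of_nonneg hr0.le, ENNReal.ofReal_mul (by positivity)]
  rw [lintegral_congr_ae h, lintegral_const]
  exact ENNReal.mul_lt_top (lintegral_Ioi_min_sq_mul_rpow_lt_top hα) (measure_lt_top _ _)

/-- Symmetry is assumed for σ only; polar coordinates carry it over to ν. -/
theorem IsNondegenerateSymmetricStable.map_neg (hν : IsNondegenerateSymmetricStable α ν)
    (hα : 0 < α) : ν.map (fun u => -u) = ν := by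
  refine Measure.ext_of_lintegral _ fun F hF => ?_
  have hFm : Measurable fun z : Rd d × ℝ => F (z.2 • z.1) * ENNReal.ofReal (z.2 ^ (-α - 1)) := by
    have : Measurable fun z : Rd d × ℝ => z.2 • z.1 := by fun_prop
    exact (hF.comp this).mul (by fun_prop)
  have hFn : Measurable fun u => F (-u) := hF.comp measurable_neg
  rw [lintegral_map hF measurable_neg,
    hν.toIsStableLevyMeasure.lintegral_polar hα hFn,
    hν.toIsStableLevyMeasure.lintegral_polar hα hF]
  conv_rhs => rw [← hν.symm]
  rw [lintegral_map hFm.lintegral_prod_right' measurable_neg]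
  simp

/-! ### The radial constant: Gamma integrals and ∫ (1 - cos r) r^(-α-1) dr -/

theorem lintegral_Ioi_rpow_mul_exp_neg_mul {a r : ℝ} (ha : 0 < a) (hr : 0 < r) :
    ∫⁻ t in Set.Ioi (0 : ℝ), ENNReal.ofReal (t ^ (a - 1) * Real.exp (-(r * t))) =
      ENNReal.ofReal ((1 / r) ^ a * Real.Gamma a) := by
  have h := Real.integral_rpow_mul_exp_neg_mul_Ioi ha hr
  have hG := Real.Gamma_pos_of_pos ha
  rw [← h, ofReal_integral_eq_lintegral_ofReal]
  · exact .of_integral_ne_zero (by rw [h]; positivity)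
  · filter_upwards [ae_restrict_mem measurableSet_Ioi] with t ht
    have : 0 < t := ht
    positivity

theorem lintegral_Ioi_rpow_mul_exp_neg_mul_sq {a w : ℝ} (ha : 0 < a) (hw : 0 < w) :
    ∫⁻ s in Set.Ioi (0 : ℝ), ENNReal.ofReal (s ^ (a - 1) * Real.exp (-(w * s ^ 2))) =
      ENNReal.ofReal (w ^ (-(a / 2)) * (1 / 2) * Real.Gamma (a / 2)) := by
  have h := integral_rpow_mul_exp_neg_mul_rpow (p := 2) (q := a - 1) (b := w) two_pos
    (by linarith) hw
  have hG := Real.Gamma_pos_of_pos (half_pos ha)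
  simp only [sub_add_cancel, Real.rpow_ofNat, neg_mul, neg_div] at h
  rw [← h, ofReal_integral_eq_lintegral_ofReal]
  · exact .of_integral_ne_zero (by rw [h]; positivity)
  · filter_upwards [ae_restrict_mem measurableSet_Ioi] with t ht
    have : 0 < t := ht
    positivity

theorem lintegral_Ioi_one_sub_cos_mul_exp_neg {s : ℝ} (hs : 0 < s) :
    ∫⁻ r in Set.Ioi (0 : ℝ), ENNReal.ofReal ((1 - Real.cos r) * Real.exp (-(r * s))) =
      ENNReal.ofReal (1 / (s * (1 + s ^ 2))) := by
  have hre : (-(s : ℂ) + Complex.I).re < 0 := by simpa using hs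
  have hint := integrableOn_exp_mul_complex_Ioi hre 0
  have hval := integral_exp_mul_complex_Ioi hre 0
  have hcos : ∀ r : ℝ, Complex.re (Complex.exp ((-(s : ℂ) + Complex.I) * r)) =
      Real.cos r * Real.exp (-(r * s)) := by
    intro r
    rw [Complex.exp_re]
    simp
    ring_nf
  have hci : IntegrableOn (fun r : ℝ => Real.cos r * Real.exp (-(r * s))) (Set.Ioi 0) := by
    have h := hint.re
    simp only [RCLike.re_to_complex, hcos] at h
    exact h
  have hcv : ∫ r in Set.Ioi (0 : ℝ), Real.cos r * Real.exp (-(r * s)) = s / (1 + s ^ 2) := by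
    have h := integral_re hint
    simp only [RCLike.re_to_complex, hcos] at h
    rw [h, hval]
    simp [Complex.div_re, Complex.normSq_apply]
    ring
  have hei : IntegrableOn (fun r : ℝ => Real.exp (-(r * s))) (Set.Ioi 0) := by
    simpa only [neg_mul, mul_comm s] using
      integrableOn_exp_mul_Ioi (a := -s) (by linarith) 0
  have hev : ∫ r in Set.Ioi (0 : ℝ), Real.exp (-(r * s)) = 1 / s := by
    have := integral_exp_mul_Ioi (a := -s) (by linarith) 0
    simpa only [neg_mul, mul_comm s, mul_zero, zero_mul, neg_zero, Real.exp_zero,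
      neg_div_neg_eq] using this
  have hsub : ∀ r : ℝ, (1 - Real.cos r) * Real.exp (-(r * s)) =
      Real.exp (-(r * s)) - Real.cos r * Real.exp (-(r * s)) := fun r => by ring
  have hint' := hei.sub hci
  simp only [IntegrableOn, Pi.sub_def, ← hsub] at hint'
  rw [← ofReal_integral_eq_lintegral_ofReal hint']
  · simp only [hsub]
    rw [integral_sub hei hci, hev, hcv]
    congr 1
    field_simp
    ring
  · refine Filter.Eventually.of_forall fun r => ?_
    exact mul_nonneg (by linarith [Real.cos_le_one r]) (Real.exp_pos _).le

/-- Write 1/(1 + s²) = ∫ exp(-w(1 + s²)) dw and exchange: the s-integral is Gaussian, and a Gamma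
integral in w remains. -/
theorem lintegral_Ioi_rpow_div_one_add_sq (hα : α ∈ Set.Ioo (0 : ℝ) 2) :
    ∫⁻ s in Set.Ioi (0 : ℝ), ENNReal.ofReal (s ^ (α - 1) / (1 + s ^ 2)) =
      ENNReal.ofReal (1 / 2 * Real.Gamma (α / 2) * Real.Gamma (1 - α / 2)) := by
  obtain ⟨h0, h2⟩ := hα
  have hG := Real.Gamma_pos_of_pos (half_pos h0)
  calc ∫⁻ s in Set.Ioi (0 : ℝ), ENNReal.ofReal (s ^ (α - 1) / (1 + s ^ 2))
      = ∫⁻ s in Set.Ioi (0 : ℝ), ∫⁻ w in Set.Ioi (0 : ℝ),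
          ENNReal.ofReal (Real.exp (-w) * (s ^ (α - 1) * Real.exp (-(w * s ^ 2)))) := by
        refine setLIntegral_congr_fun measurableSet_Ioi fun s hs => ?_
        have hs0 : 0 < s := hs
        have h := lintegral_Ioi_rpow_mul_exp_neg_mul (a := 1) (r := 1 + s ^ 2) one_pos
          (by positivity)
        simp only [sub_self, Real.rpow_zero, one_mul, Real.rpow_one, Real.Gamma_one, mul_one] at h
        rw [div_eq_mul_one_div, ENNReal.ofReal_mul (by positivity), ← h,
          ← lintegral_const_mul' _ _ ENNReal.ofReal_ne_top]
        refine lintegral_congr fun w => ?_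
        rw [← ENNReal.ofReal_mul (by positivity), mul_left_comm, ← Real.exp_add]
        ring_nf
    _ = ∫⁻ w in Set.Ioi (0 : ℝ), ∫⁻ s in Set.Ioi (0 : ℝ),
          ENNReal.ofReal (Real.exp (-w) * (s ^ (α - 1) * Real.exp (-(w * s ^ 2)))) :=
        lintegral_lintegral_swap (by fun_prop)
    _ = ∫⁻ w in Set.Ioi (0 : ℝ), ENNReal.ofReal (1 / 2 * Real.Gamma (α / 2)) *
          ENNReal.ofReal (w ^ ((1 - α / 2) - 1) * Real.exp (-(1 * w))) := by
        refine setLIntegral_congr_fun measurableSet_Ioi fun w hw => ?_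
        have hw0 : 0 < w := hw
        simp only [ENNReal.ofReal_mul (Real.exp_pos _).le]
        rw [lintegral_const_mul' _ _ ENNReal.ofReal_ne_top,
          lintegral_Ioi_rpow_mul_exp_neg_mul_sq h0 hw0, ← ENNReal.ofReal_mul (Real.exp_pos _).le,
          ← ENNReal.ofReal_mul (by positivity)]
        congr 1
        ring_nf
    _ = _ := by
        rw [lintegral_const_mul' _ _ ENNReal.ofReal_ne_top,
          lintegral_Ioi_rpow_mul_exp_neg_mul (by linarith) one_pos,
          ← ENNReal.ofReal_mul (by positivity)]
        simp

/-- The factor relating the spherical part of a stable Lévy measure to its spectral measure. -/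
noncomputable def spectralConst (α : ℝ) : ℝ :=
  -Real.cos (α * (Real.pi / 2)) * (Real.Gamma (2 - α) / (α * (α - 1)))

/-- Euler's reflection formula at α - 1 and at α/2. Their sines are linked by sin(π(α - 1)) = -2
sin(πα/2) cos(πα/2), and the cosine cancels the one in the constant. -/
theorem spectralConst_mul_Gamma (hα : α ∈ Set.Ioo (1 : ℝ) 2) :
    spectralConst α * Real.Gamma (α + 1) =
      1 / 2 * Real.Gamma (α / 2) * Real.Gamma (1 - α / 2) := by
  obtain ⟨h1, h2⟩ := hα
  have hG1 : Real.Gamma (α + 1) = α * ((α - 1) * Real.Gamma (α - 1)) := by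
    rw [Real.Gamma_add_one (by linarith)]
    congr 1
    conv_lhs => rw [← sub_add_cancel α 1, Real.Gamma_add_one (by linarith)]
  have hR := Real.Gamma_mul_Gamma_one_sub (α - 1)
  have hS := Real.Gamma_mul_Gamma_one_sub (α / 2)
  have e1 : 1 - (α - 1) = 2 - α := by ring
  have e2 : Real.pi * (α - 1) = 2 * (Real.pi * (α / 2)) - Real.pi := by ring
  rw [e1, e2, Real.sin_sub_pi, Real.sin_two_mul] at hR
  have hsin : 0 < Real.sin (Real.pi * (α / 2)) :=
    Real.sin_pos_of_pos_of_lt_pi (by positivity) (by nlinarith [Real.pi_pos])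
  have hcos : Real.cos (Real.pi * (α / 2)) < 0 :=
    Real.cos_neg_of_pi_div_two_lt_of_lt (by nlinarith [Real.pi_pos]) (by nlinarith [Real.pi_pos])
  have hαne : α ≠ 0 := by linarith
  have hα1 : α - 1 ≠ 0 := by linarith
  rw [mul_assoc, hS, hG1, spectralConst, show α * (Real.pi / 2) = Real.pi * (α / 2) by ring]
  calc -Real.cos (Real.pi * (α / 2)) * (Real.Gamma (2 - α) / (α * (α - 1))) *
        (α * ((α - 1) * Real.Gamma (α - 1)))
      = -Real.cos (Real.pi * (α / 2)) * (Real.Gamma (α - 1) * Real.Gamma (2 - α)) := by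
        field_simp
    _ = _ := by
        rw [hR]
        have hcne := hcos.ne
        generalize Real.cos (Real.pi * (α / 2)) = c at hcne
        field_simp

theorem spectralConst_pos (hα : α ∈ Set.Ioo (1 : ℝ) 2) : 0 < spectralConst α := by
  have h := spectralConst_mul_Gamma hα
  obtain ⟨h1, h2⟩ := hα
  have hG := Real.Gamma_pos_of_pos (show 0 < α + 1 by linarith)
  have hG1 := Real.Gamma_pos_of_pos (show 0 < α / 2 by linarith)
  have hG2 := Real.Gamma_pos_of_pos (show 0 < 1 - α / 2 by linarith)
  refine pos_of_mul_pos_left ?_ hG.le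
  rw [h]
  positivity

/-- Multiply by Γ(α + 1) and use Γ(α + 1) r^(-α-1) = ∫ s^α exp(-rs) ds. Everything is nonnegative,
so Tonelli reduces the claim to the Laplace transform of 1 - cos and the preceding integral. -/
theorem lintegral_Ioi_one_sub_cos_mul_rpow (hα : α ∈ Set.Ioo (1 : ℝ) 2) :
    ∫⁻ r in Set.Ioi (0 : ℝ), ENNReal.ofReal ((1 - Real.cos r) * r ^ (-α - 1)) =
      ENNReal.ofReal (spectralConst α) := by
  have hC := spectralConst_pos hα
  have hCG := spectralConst_mul_Gamma hα
  obtain ⟨h1, h2⟩ := hα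
  have hG := Real.Gamma_pos_of_pos (show 0 < α + 1 by linarith)
  have hGne : ENNReal.ofReal (Real.Gamma (α + 1)) ≠ 0 := by simpa using hG
  have key : (∫⁻ r in Set.Ioi (0 : ℝ), ENNReal.ofReal ((1 - Real.cos r) * r ^ (-α - 1))) *
      ENNReal.ofReal (Real.Gamma (α + 1)) =
      ENNReal.ofReal (spectralConst α) * ENNReal.ofReal (Real.Gamma (α + 1)) := by
    rw [← ENNReal.ofReal_mul hC.le, hCG, ← lintegral_Ioi_rpow_div_one_add_sq ⟨by linarith, h2⟩,
      ← lintegral_mul_const' _ _ ENNReal.ofReal_ne_top]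
    calc ∫⁻ r in Set.Ioi (0 : ℝ), ENNReal.ofReal ((1 - Real.cos r) * r ^ (-α - 1)) *
          ENNReal.ofReal (Real.Gamma (α + 1))
        = ∫⁻ r in Set.Ioi (0 : ℝ), ∫⁻ s in Set.Ioi (0 : ℝ),
            ENNReal.ofReal (s ^ α * ((1 - Real.cos r) * Real.exp (-(r * s)))) := by
          refine setLIntegral_congr_fun measurableSet_Ioi fun r hr => ?_
          have hr0 : 0 < r := hr
          have hc : 0 ≤ 1 - Real.cos r := by linarith [Real.cos_le_one r]
          have h := lintegral_Ioi_rpow_mul_exp_neg_mul (a := α + 1) (r := r) (by linarith) hr0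
          rw [← ENNReal.ofReal_mul (by positivity), mul_assoc, ENNReal.ofReal_mul hc,
            show r ^ (-α - 1) = (1 / r) ^ (α + 1) by
              rw [one_div, Real.inv_rpow hr0.le, ← Real.rpow_neg hr0.le]; congr 1; ring,
            ← h, ← lintegral_const_mul' _ _ ENNReal.ofReal_ne_top]
          refine lintegral_congr fun s => ?_
          rw [← ENNReal.ofReal_mul hc, add_sub_cancel_right]
          congr 1
          ring
      _ = ∫⁻ s in Set.Ioi (0 : ℝ), ∫⁻ r in Set.Ioi (0 : ℝ),
            ENNReal.ofReal (s ^ α * ((1 - Real.cos r) * Real.exp (-(r * s)))) :=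
          lintegral_lintegral_swap (by fun_prop)
      _ = _ := by
          refine setLIntegral_congr_fun measurableSet_Ioi fun s hs => ?_
          have hs0 : 0 < s := hs
          have hp : 0 ≤ s ^ α := by positivity
          simp only [ENNReal.ofReal_mul hp]
          rw [lintegral_const_mul' _ _ ENNReal.ofReal_ne_top,
            lintegral_Ioi_one_sub_cos_mul_exp_neg hs0, ← ENNReal.ofReal_mul hp,
            Real.rpow_sub_one hs0.ne']
          congr 1
          field_simp
  exact (ENNReal.mul_left_inj hGne ENNReal.ofReal_ne_top).1 key

theorem lintegral_Ioi_one_sub_cos_mul_mul_rpow (hα : α ∈ Set.Ioo (1 : ℝ) 2) (a : ℝ) :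
    ∫⁻ r in Set.Ioi (0 : ℝ), ENNReal.ofReal ((1 - Real.cos (r * a)) * r ^ (-α - 1)) =
      ENNReal.ofReal (spectralConst α * |a| ^ α) := by
  rcases eq_or_ne a 0 with rfl | ha
  · simp [Real.zero_rpow (show α ≠ 0 by linarith [hα.1])]
  have ha' : 0 < |a| := abs_pos.2 ha
  rw [lintegral_Ioi_eq_mul_lintegral_comp_mul (inv_pos.2 ha'),
    ENNReal.ofReal_mul (spectralConst_pos hα).le, ← lintegral_Ioi_one_sub_cos_mul_rpow hα,
    mul_comm _ (ENNReal.ofReal (|a| ^ α)), ← lintegral_const_mul' _ _ ENNReal.ofReal_ne_top,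
    ← lintegral_const_mul' _ _ ENNReal.ofReal_ne_top]
  refine setLIntegral_congr_fun measurableSet_Ioi fun s hs => ?_
  have hs0 : 0 < s := hs
  rw [← ENNReal.ofReal_mul (by positivity), ← ENNReal.ofReal_mul (by positivity)]
  have hc : Real.cos (|a|⁻¹ * s * a) = Real.cos s := by
    rw [← Real.cos_abs, abs_mul, abs_mul, abs_inv, abs_abs, abs_of_pos hs0]
    congr 1
    field_simp
  rw [hc, Real.mul_rpow (by positivity) hs0.le, Real.inv_rpow ha'.le, ← Real.rpow_neg ha'.le,
    show -(-α - 1) = α + 1 by ring, Real.rpow_add_one ha'.ne']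
  congr 1
  field_simp

/-! ### The characteristic exponent: homogeneity and two-sided bounds -/

/-- The characteristic exponent `∫ |⟨y, ξ⟩| ^ α λ₁(dy)` of a symmetric stable law. -/
noncomputable def stableExponent (α : ℝ) (ν : Measure (Rd d)) (ξ : Rd d) : ℝ :=
  ∫ y, |⟪y, ξ⟫| ^ α ∂(spectralMeasure α ν)

theorem stableExponent_nonneg (ξ : Rd d) : 0 ≤ stableExponent α ν ξ :=
  integral_nonneg fun y => by positivity

theorem stableExponent_smul (c : ℝ) (ξ : Rd d) :
    stableExponent α ν (c • ξ) = |c| ^ α * stableExponent α ν ξ := by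
  simp only [stableExponent, inner_smul_right, abs_mul]
  rw [← integral_const_mul]
  exact integral_congr_ae (Filter.Eventually.of_forall fun y =>
    Real.mul_rpow (abs_nonneg _) (abs_nonneg _))

theorem IsStableLevyMeasure.isFiniteMeasure_spectralMeasure (hν : IsStableLevyMeasure α ν) :
    IsFiniteMeasure (spectralMeasure α ν) := by
  have := hν.isFiniteMeasure_sphericalPart
  unfold spectralMeasure
  exact Measure.smul_finite _ ENNReal.ofReal_ne_top

theorem ae_norm_eq_one_spectralMeasure : ∀ᵐ y ∂(spectralMeasure α ν), ‖y‖ = 1 :=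
  Measure.ae_smul_measure ae_norm_eq_one_sphericalPart _

theorem IsStableLevyMeasure.integrable_abs_inner_rpow (hν : IsStableLevyMeasure α ν)
    (hα : 0 < α) (ξ : Rd d) :
    Integrable (fun y => |⟪y, ξ⟫| ^ α) (spectralMeasure α ν) := by
  have := hν.isFiniteMeasure_spectralMeasure
  refine Integrable.of_bound (Measurable.aestronglyMeasurable (by fun_prop)) (‖ξ‖ ^ α) ?_
  filter_upwards [ae_norm_eq_one_spectralMeasure] with y hy
  rw [Real.norm_of_nonneg (by positivity)]
  refine Real.rpow_le_rpow (abs_nonneg _) ?_ hα.le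
  simpa [hy] using abs_real_inner_le_norm y ξ

theorem IsStableLevyMeasure.measurable_stableExponent (hν : IsStableLevyMeasure α ν) :
    Measurable (stableExponent α ν) := by
  have := hν.isFiniteMeasure_spectralMeasure
  have h : StronglyMeasurable (Function.uncurry fun (ξ y : Rd d) => |⟪y, ξ⟫| ^ α) :=
    Measurable.stronglyMeasurable (by unfold Function.uncurry; fun_prop)
  exact h.integral_prod_right.measurable

theorem IsStableLevyMeasure.exists_stableExponent_le (hν : IsStableLevyMeasure α ν)
    (hα : 0 < α) : ∃ C, ∀ ξ, stableExponent α ν ξ ≤ C * ‖ξ‖ ^ α := by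
  have := hν.isFiniteMeasure_spectralMeasure
  refine ⟨(spectralMeasure α ν).real Set.univ, fun ξ => ?_⟩
  have h : stableExponent α ν ξ ≤ ∫ _, ‖ξ‖ ^ α ∂(spectralMeasure α ν) := by
    refine integral_mono_ae (hν.integrable_abs_inner_rpow hα ξ) (integrable_const _) ?_
    filter_upwards [ae_norm_eq_one_spectralMeasure] with y hy
    refine Real.rpow_le_rpow (abs_nonneg _) ?_ hα.le
    simpa [hy] using abs_real_inner_le_norm y ξ
  simpa using h

theorem IsNondegenerateSymmetricStable.exists_le_stableExponent
    (hν : IsNondegenerateSymmetricStable α ν) (hα : 0 < α) :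
    ∃ c, 0 < c ∧ ∀ ξ, c * ‖ξ‖ ^ α ≤ stableExponent α ν ξ := by
  refine ⟨_, hν.nondegenerate, fun ξ => ?_⟩
  rcases eq_or_ne ξ 0 with rfl | hξ
  · simp [Real.zero_rpow hα.ne', stableExponent_nonneg]
  have hξ0 : 0 < ‖ξ‖ := norm_pos_iff.2 hξ
  let y : Metric.sphere (0 : Rd d) 1 := ⟨‖ξ‖⁻¹ • ξ, by simp [norm_smul, hξ0.ne']⟩
  have hle := ciInf_le (f := fun y : Metric.sphere (0 : Rd d) 1 =>
      ∫ x, |⟪(y : Rd d), x⟫| ^ α ∂(spectralMeasure α ν))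
    ⟨0, by rintro _ ⟨y, rfl⟩; exact integral_nonneg fun x => by positivity⟩ y
  have hy : ∫ x, |⟪(y : Rd d), x⟫| ^ α ∂(spectralMeasure α ν) =
      stableExponent α ν (‖ξ‖⁻¹ • ξ) := by
    simp only [stableExponent, y]
    simp_rw [real_inner_comm]
  rw [hy] at hle
  have h := mul_le_mul_of_nonneg_right hle (show 0 ≤ ‖ξ‖ ^ α by positivity)
  refine h.trans_eq ?_
  rw [stableExponent_smul, abs_inv, abs_norm, mul_right_comm,
    ← Real.mul_rpow (by positivity) hξ0.le, inv_mul_cancel₀ hξ0.ne', Real.one_rpow, one_mul]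

/-! ### The characteristic function of the stable law and Euler's identity -/

theorem min_abs_inner_le (u ξ : Rd d) :
    min |⟪u, ξ⟫| (⟪u, ξ⟫ ^ 2) ≤ (‖ξ‖ + ‖ξ‖ ^ 2) * min ‖u‖ (‖u‖ ^ 2) := by
  have h := abs_real_inner_le_norm u ξ
  have h2 : ⟪u, ξ⟫ ^ 2 ≤ (‖u‖ * ‖ξ‖) ^ 2 := by
    rw [← sq_abs]
    gcongr
  have hu := norm_nonneg u
  have hξ := norm_nonneg ξ
  rcases min_cases ‖u‖ (‖u‖ ^ 2) with ⟨h', -⟩ | ⟨h', -⟩ <;> rw [h']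
  · refine (min_le_left _ _).trans (h.trans ?_)
    nlinarith [mul_nonneg hu (sq_nonneg ‖ξ‖)]
  · refine (min_le_right _ _).trans (h2.trans ?_)
    nlinarith [mul_nonneg hξ (sq_nonneg ‖u‖)]

theorem norm_cexp_sub_one_sub_le (x : ℝ) :
    ‖Complex.exp (Complex.I * x) - 1 - Complex.I * x‖ ≤ 2 * min |x| (x ^ 2) := by
  have hx : ‖Complex.I * (x : ℂ)‖ = |x| := by simp
  rcases le_total |x| 1 with h | h
  · have h1 := Complex.norm_exp_sub_one_sub_id_le (x := Complex.I * x) (by rwa [hx])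
    rw [hx, sq_abs] at h1
    rw [min_eq_right (by rw [← sq_abs]; nlinarith [abs_nonneg x])]
    nlinarith [sq_nonneg x]
  · have h1 := norm_sub_le (Complex.exp (Complex.I * x) - 1) (Complex.I * x)
    have h2 := Real.norm_exp_I_mul_ofReal_sub_one_le (x := x)
    rw [Real.norm_eq_abs] at h2
    rw [hx] at h1
    rw [min_eq_left (by rw [← sq_abs]; nlinarith)]
    linarith

theorem norm_mul_cexp_sub_one_le (x r : ℝ) (hr : |r| ≤ 2) :
    ‖Complex.I * x * (Complex.exp (Complex.I * (r * x : ℝ)) - 1)‖ ≤ 2 * min |x| (x ^ 2) := by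
  have hx : ‖Complex.I * (x : ℂ)‖ = |x| := by simp
  have h2 := Real.norm_exp_I_mul_ofReal_sub_one_le (x := r * x)
  have h3 : ‖Complex.exp (Complex.I * (r * x : ℝ)) - 1‖ ≤ 2 := by
    refine (norm_sub_le _ _).trans ?_
    rw [Complex.norm_exp_I_mul_ofReal]
    norm_num
  rw [Real.norm_eq_abs, abs_mul] at h2
  rw [norm_mul, hx]
  have hx0 := abs_nonneg x
  rcases min_cases |x| (x ^ 2) with ⟨h, -⟩ | ⟨h, -⟩ <;> rw [h]
  · nlinarith
  · rw [← sq_abs]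
    nlinarith [mul_le_mul_of_nonneg_right hr hx0]

theorem IsStableLevyMeasure.integrable_min_inner (hν : IsStableLevyMeasure α ν)
    (hα : α ∈ Set.Ioo (1 : ℝ) 2) (ξ : Rd d) :
    Integrable (fun u : Rd d => 2 * min |⟪u, ξ⟫| (⟪u, ξ⟫ ^ 2)) ν := by
  refine (((hν.integrable_min_norm hα).const_mul (‖ξ‖ + ‖ξ‖ ^ 2)).mono' (by fun_prop)
    (Filter.Eventually.of_forall fun u => ?_)).const_mul 2
  rw [Real.norm_of_nonneg (by positivity)]
  exact min_abs_inner_le u ξ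

theorem IsStableLevyMeasure.integrable_cexp_sub_one_sub (hν : IsStableLevyMeasure α ν)
    (hα : α ∈ Set.Ioo (1 : ℝ) 2) (ξ : Rd d) :
    Integrable (fun u : Rd d => Complex.exp (Complex.I * (⟪u, ξ⟫ : ℝ)) - 1
        - Complex.I * (⟪u, ξ⟫ : ℝ)) ν :=
  (hν.integrable_min_inner hα ξ).mono' (by fun_prop)
    (Filter.Eventually.of_forall fun _ => norm_cexp_sub_one_sub_le _)

theorem IsStableLevyMeasure.integral_one_sub_cos (hν : IsStableLevyMeasure α ν)
    (hα : α ∈ Set.Ioo (1 : ℝ) 2) (ξ : Rd d) :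
    ∫ u, (1 - Real.cos ⟪u, ξ⟫) ∂ν = stableExponent α ν ξ := by
  have hα0 : 0 < α := by linarith [hα.1]
  have hC := spectralConst_pos hα
  rw [integral_eq_lintegral_of_nonneg_ae
    (Filter.Eventually.of_forall fun u => by simp [Real.cos_le_one]) (by fun_prop),
    stableExponent, integral_eq_lintegral_of_nonneg_ae
    (Filter.Eventually.of_forall fun u => by positivity)
    (Measurable.aestronglyMeasurable (by fun_prop)),
    hν.lintegral_polar hα0 (by fun_prop), spectralMeasure, lintegral_smul_measure, smul_eq_mul,
    ← lintegral_const_mul' _ _ ENNReal.ofReal_ne_top]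
  congr 1
  refine lintegral_congr fun y => ?_
  have h := lintegral_Ioi_one_sub_cos_mul_mul_rpow hα ⟪y, ξ⟫
  rw [ENNReal.ofReal_mul hC.le] at h
  refine Eq.trans (lintegral_congr fun r => ?_) h
  rw [← ENNReal.ofReal_mul (by simp [Real.cos_le_one]), real_inner_smul_left]

/-- Averaging over u and -u cancels the sine and the compensator, leaving -(1 - cos). -/
theorem IsNondegenerateSymmetricStable.integral_cexp_sub_one_sub
    (hν : IsNondegenerateSymmetricStable α ν) (hα : α ∈ Set.Ioo (1 : ℝ) 2) (ξ : Rd d) :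
    ∫ u, (Complex.exp (Complex.I * (⟪u, ξ⟫ : ℝ)) - 1 - Complex.I * (⟪u, ξ⟫ : ℝ)) ∂ν =
      -(stableExponent α ν ξ : ℂ) := by
  set F : Rd d → ℂ := fun u => Complex.exp (Complex.I * (⟪u, ξ⟫ : ℝ)) - 1
    - Complex.I * (⟪u, ξ⟫ : ℝ) with hF
  have hint : Integrable F ν := hν.toIsStableLevyMeasure.integrable_cexp_sub_one_sub hα ξ
  have hmp : MeasurePreserving (fun u : Rd d => -u) ν ν :=
    ⟨measurable_neg, hν.map_neg (by linarith [hα.1])⟩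
  have hneg : ∫ u, F (-u) ∂ν = ∫ u, F u ∂ν :=
    hmp.integral_comp (MeasurableEquiv.neg (Rd d)).measurableEmbedding F
  have hint' : Integrable (fun u => F (-u)) ν := hmp.integrable_comp_of_integrable hint
  have hsum : ∀ u, F u + F (-u) = ((-2 * (1 - Real.cos ⟪u, ξ⟫) : ℝ) : ℂ) := by
    intro u
    simp only [hF, inner_neg_left, Complex.ofReal_neg]
    push_cast
    rw [Complex.cos, mul_comm Complex.I]
    ring_nf
  have h2 : 2 * ∫ u, F u ∂ν = ((-2 * stableExponent α ν ξ : ℝ) : ℂ) := by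
    calc 2 * ∫ u, F u ∂ν = ∫ u, (F u + F (-u)) ∂ν := by
          rw [integral_add hint hint', hneg]; ring
      _ = _ := by
          simp only [hsum]
          rw [integral_complex_ofReal, integral_const_mul,
            hν.toIsStableLevyMeasure.integral_one_sub_cos hα]
  push_cast at h2
  linear_combination h2 / 2

theorem IsStableLaw.charFun_eq (hμ : IsStableLaw ν μ)
    (hν : IsNondegenerateSymmetricStable α ν) (hα : α ∈ Set.Ioo (1 : ℝ) 2) (ξ : Rd d) :
    charFun μ ξ = ((Real.exp (-stableExponent α ν ξ) : ℝ) : ℂ) := by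
  have h := hμ.fourier ξ
  have hc : ∀ u : Rd d, ⟪ξ, u⟫ = ⟪u, ξ⟫ := fun u => real_inner_comm _ _
  simp only [hc] at h
  simp_rw [charFun_apply, mul_comm _ Complex.I]
  rw [h, hν.integral_cexp_sub_one_sub hα]
  push_cast
  rfl

/-- Euler's identity for a function homogeneous of degree α: differentiate the exponent at rξ, equal
to -|r|^α ψ(ξ), under the integral at r = 1. -/
theorem IsNondegenerateSymmetricStable.integral_mul_cexp_sub_one
    (hν : IsNondegenerateSymmetricStable α ν) (hα : α ∈ Set.Ioo (1 : ℝ) 2) (ξ : Rd d) :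
    ∫ u, Complex.I * (⟪u, ξ⟫ : ℝ) * (Complex.exp (Complex.I * (⟪u, ξ⟫ : ℝ)) - 1) ∂ν =
      -((α * stableExponent α ν ξ : ℝ) : ℂ) := by
  set F : ℝ → Rd d → ℂ := fun r u => Complex.exp (Complex.I * (r * ⟪u, ξ⟫ : ℝ)) - 1
    - Complex.I * (r * ⟪u, ξ⟫ : ℝ) with hF
  set F' : ℝ → Rd d → ℂ := fun r u => Complex.I * (⟪u, ξ⟫ : ℝ) *
    (Complex.exp (Complex.I * (r * ⟪u, ξ⟫ : ℝ)) - 1) with hF'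
  have hFi : ∀ r, ∫ u, F r u ∂ν = ((-(|r| ^ α * stableExponent α ν ξ) : ℝ) : ℂ) := by
    intro r
    have h := hν.integral_cexp_sub_one_sub hα (r • ξ)
    simp only [inner_smul_right, stableExponent_smul] at h
    rw [Complex.ofReal_neg]
    exact h
  have hint : Integrable (F 1) ν := by
    simpa [hF] using hν.toIsStableLevyMeasure.integrable_cexp_sub_one_sub hα ξ
  have hder : HasDerivAt (fun r => ∫ u, F r u ∂ν) (∫ u, F' 1 u ∂ν) 1 := by
    -- On the neighbourhood (0, 2) of 1 the factor |r| is at most 2, which gives one dominating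
    -- function for all r.
    refine (hasDerivAt_integral_of_dominated_loc_of_deriv_le (s := Set.Ioo 0 2)
      (bound := fun u => 2 * min |⟪u, ξ⟫| (⟪u, ξ⟫ ^ 2))
      (Ioo_mem_nhds one_pos one_lt_two) ?_ hint ?_ ?_
      (hν.toIsStableLevyMeasure.integrable_min_inner hα ξ) ?_).2
    · exact Filter.Eventually.of_forall fun r => by simp only [hF]; fun_prop
    · simp only [hF']; fun_prop
    · exact Filter.Eventually.of_forall fun u r hr => norm_mul_cexp_sub_one_le _ _
        (abs_le.2 ⟨by linarith [hr.1], hr.2.le⟩)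
    · refine Filter.Eventually.of_forall fun u r _ => ?_
      have h1 : HasDerivAt (fun r : ℝ => Complex.I * ((r * ⟪u, ξ⟫ : ℝ) : ℂ))
          (Complex.I * (⟪u, ξ⟫ : ℝ)) r := by
        have := (((hasDerivAt_id r).mul_const ⟪u, ξ⟫).ofReal_comp).const_mul Complex.I
        simpa using this
      have h2 := (h1.cexp.sub_const 1).sub h1
      refine h2.congr_deriv ?_
      simp only [hF']
      ring
  have hder' : HasDerivAt (fun r => ∫ u, F r u ∂ν)
      ((-(α * stableExponent α ν ξ) : ℝ) : ℂ) 1 := by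
    simp only [hFi]
    have h1 : HasDerivAt (fun r : ℝ => |r| ^ α) α 1 := by
      have := Real.hasDerivAt_rpow_const (x := 1) (p := α) (Or.inl one_ne_zero)
      rw [Real.one_rpow, mul_one] at this
      refine this.congr_of_eventuallyEq ?_
      filter_upwards [lt_mem_nhds (show (0 : ℝ) < 1 from one_pos)] with r hr
      rw [abs_of_pos hr]
    exact (h1.mul_const _).neg.ofReal_comp
  have := hder.unique hder'
  simpa [hF'] using this

/-! ### Jensen's inequality and the estimate by σ_α(∇f) -/

theorem rpow_lintegral_le_lintegral_rpow {Y : Type*} [MeasurableSpace Y] (κ : Measure Y)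
    [IsProbabilityMeasure κ] {p : ℝ} (hp : 1 ≤ p) {g : Y → ENNReal} (hg : AEMeasurable g κ) :
    (∫⁻ y, g y ∂κ) ^ p ≤ ∫⁻ y, g y ^ p ∂κ := by
  rcases hp.eq_or_lt with rfl | hp1
  · simp
  have hpq := Real.HolderConjugate.conjExponent hp1
  have h := ENNReal.lintegral_mul_le_Lp_mul_Lq κ hpq hg
    (aemeasurable_const (b := (1 : ENNReal)))
  simp only [Pi.mul_apply, mul_one, ENNReal.one_rpow, lintegral_const, measure_univ] at h
  have h2 := ENNReal.rpow_le_rpow h (show 0 ≤ p by linarith)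
  rwa [← ENNReal.rpow_mul, one_div_mul_cancel (by linarith), ENNReal.rpow_one] at h2

/-- Minkowski's integral inequality in the form needed here: since κ is a probability, Jensen and
Tonelli suffice. -/
theorem lintegral_rpow_lintegral_le {X Y : Type*} [MeasurableSpace X] [MeasurableSpace Y]
    (m : Measure X) [SFinite m] (κ : Measure Y) [IsProbabilityMeasure κ] {p : ℝ} (hp : 1 ≤ p)
    {H : X → Y → ENNReal} (hH : Measurable (Function.uncurry H)) :
    ∫⁻ x, (∫⁻ y, H x y ∂κ) ^ p ∂m ≤ ∫⁻ y, ∫⁻ x, H x y ^ p ∂m ∂κ := by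
  rw [← lintegral_lintegral_swap (f := fun x y => H x y ^ p) (hH.pow_const p).aemeasurable]
  exact lintegral_mono fun x =>
    rpow_lintegral_le_lintegral_rpow κ hp (hH.comp measurable_prodMk_left).aemeasurable

theorem eLpNorm_ofReal_rpow {X E : Type*} [MeasurableSpace X] [NormedAddCommGroup E]
    (m : Measure X) {p : ℝ} (hp : 0 < p) (g : X → E) :
    eLpNorm g (ENNReal.ofReal p) m ^ p = ∫⁻ x, ‖g x‖ₑ ^ p ∂m := by
  rw [eLpNorm_eq_lintegral_rpow_enorm_toReal (by simpa using hp) ENNReal.ofReal_ne_top,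
    ENNReal.toReal_ofReal hp.le, ← ENNReal.rpow_mul, one_div_mul_cancel hp.ne', ENNReal.rpow_one]

theorem enorm_sub_le_lintegral_fderiv {f : Rd d → ℝ} (hf : ContDiff ℝ 1 f) (x v : Rd d) :
    ‖f (x + v) - f x‖ₑ ≤ ∫⁻ s in Set.Ioc (0 : ℝ) 1, ‖fderiv ℝ f (x + s • v) v‖ₑ := by
  have hd : ∀ s : ℝ, HasDerivAt (fun s : ℝ => f (x + s • v)) (fderiv ℝ f (x + s • v) v) s := by
    intro s
    have h1 : HasDerivAt (fun s : ℝ => x + s • v) v s := by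
      simpa using ((hasDerivAt_id s).smul_const v).const_add x
    exact ((hf.differentiable one_ne_zero).differentiableAt.hasFDerivAt).comp_hasDerivAt s h1
  have hc : Continuous fun s : ℝ => fderiv ℝ f (x + s • v) v := by
    have := hf.continuous_fderiv one_ne_zero
    fun_prop
  have h := intervalIntegral.integral_eq_sub_of_hasDerivAt (fun s _ => hd s)
    (hc.intervalIntegrable 0 1)
  simp only [one_smul, zero_smul, add_zero] at h
  rw [← h, intervalIntegral.integral_of_le zero_le_one]
  exact enorm_integral_le_lintegral_enorm _

/-- The increment is the mean over s in (0, 1] of the derivative at x + sv along v; Jensen applies,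
and translation invariance removes sv. -/
theorem lintegral_enorm_translate_sub_rpow_le {f : Rd d → ℝ} (hf : ContDiff ℝ 1 f) {p : ℝ}
    (hp : 1 ≤ p) (v : Rd d) :
    ∫⁻ x, ‖f (x + v) - f x‖ₑ ^ p ≤ ∫⁻ x, ‖fderiv ℝ f x v‖ₑ ^ p := by
  have hc := hf.continuous_fderiv one_ne_zero
  have hprob : IsProbabilityMeasure (volume.restrict (Set.Ioc (0 : ℝ) 1)) := ⟨by simp⟩
  have hH : Measurable (Function.uncurry fun (x : Rd d) (s : ℝ) =>
      ‖fderiv ℝ f (x + s • v) v‖ₑ) := by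
    refine Continuous.measurable ?_
    unfold Function.uncurry
    fun_prop
  calc ∫⁻ x, ‖f (x + v) - f x‖ₑ ^ p
      ≤ ∫⁻ x, (∫⁻ s in Set.Ioc (0 : ℝ) 1, ‖fderiv ℝ f (x + s • v) v‖ₑ) ^ p :=
        lintegral_mono fun x => ENNReal.rpow_le_rpow (enorm_sub_le_lintegral_fderiv hf x v)
          (by linarith)
    _ ≤ ∫⁻ s in Set.Ioc (0 : ℝ) 1, ∫⁻ x, ‖fderiv ℝ f (x + s • v) v‖ₑ ^ p :=
        lintegral_rpow_lintegral_le volume _ hp hH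
    _ = ∫⁻ _ in Set.Ioc (0 : ℝ) 1, ∫⁻ x, ‖fderiv ℝ f x v‖ₑ ^ p := by
        refine lintegral_congr fun s => ?_
        exact lintegral_add_right_eq_self (fun x => ‖fderiv ℝ f x v‖ₑ ^ p) (s • v)
    _ = _ := by simp

/-- Both laws have characteristic function exp(-|t|^α ψ(θ)), because σ_α(θ)^α = ψ(θ). -/
theorem IsStableLaw.map_inner_eq (hμ : IsStableLaw ν μ)
    (hν : IsNondegenerateSymmetricStable α ν) (hα : α ∈ Set.Ioo (1 : ℝ) 2)
    {Ω : Type*} [MeasurableSpace Ω] (P : Measure Ω) [IsProbabilityMeasure P] {Y : Ω → ℝ}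
    (hY : AEMeasurable Y P)
    (hYc : ∀ ξ : ℝ, ∫ w, Complex.exp (Complex.I * ((ξ * Y w : ℝ) : ℂ)) ∂P =
        ((Real.exp (-(|ξ| ^ α)) : ℝ) : ℂ)) (θ : Rd d) :
    μ.map (fun y => ⟪y, θ⟫) = P.map (fun w => sigmaNorm α ν θ * Y w) := by
  have := hμ.isProbabilityMeasure
  have hα0 : 0 < α := by linarith [hα.1]
  have hm : AEMeasurable (fun y : Rd d => ⟪y, θ⟫) μ := by fun_prop
  have hm' : AEMeasurable (fun w => sigmaNorm α ν θ * Y w) P := by fun_prop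
  have h1 := Measure.isProbabilityMeasure_map hm
  have h2 := Measure.isProbabilityMeasure_map hm'
  refine Measure.ext_of_charFun (funext fun t => ?_)
  have hL : charFun (μ.map (fun y => ⟪y, θ⟫)) t = charFun μ (t • θ) := by
    rw [charFun_apply, charFun_apply, integral_map hm (by fun_prop)]
    simp [inner_smul_right, mul_comm]
  have hR : charFun (P.map (fun w => sigmaNorm α ν θ * Y w)) t =
      ((Real.exp (-(|t * sigmaNorm α ν θ| ^ α)) : ℝ) : ℂ) := by
    rw [← hYc, charFun_apply, integral_map hm' (by fun_prop)]
    refine integral_congr_ae (Filter.Eventually.of_forall fun w => ?_)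
    simp only [RCLike.inner_apply, conj_trivial, ← mul_assoc, mul_comm Complex.I]
  have hs : |sigmaNorm α ν θ| ^ α = stableExponent α ν θ := by
    have h0 := stableExponent_nonneg (α := α) (ν := ν) θ
    change |stableExponent α ν θ ^ (1 / α)| ^ α = _
    rw [abs_of_nonneg (by positivity), ← Real.rpow_mul h0, one_div_mul_cancel hα0.ne',
      Real.rpow_one]
  rw [hL, hR, hμ.charFun_eq hν hα, stableExponent_smul, abs_mul,
    Real.mul_rpow (abs_nonneg _) (abs_nonneg _), hs]

theorem enorm_stableSemigroup_sub_le [IsProbabilityMeasure μ] {f : Rd d → ℝ}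
    (hf : Continuous f) (hfc : HasCompactSupport f) (t : ℝ) (x : Rd d) :
    ‖stableSemigroup α μ t f x - f x‖ₑ ≤ ∫⁻ y, ‖f (x + t ^ (1 / α) • y) - f x‖ₑ ∂μ := by
  have hint : Integrable (fun y => f (x + t ^ (1 / α) • y)) μ := by
    obtain ⟨C, hC⟩ := hfc.exists_bound_of_continuous hf
    exact Integrable.of_bound (by fun_prop) C (Filter.Eventually.of_forall fun y => hC _)
  have h : stableSemigroup α μ t f x - f x = ∫ y, (f (x + t ^ (1 / α) • y) - f x) ∂μ := by
    rw [integral_sub hint (integrable_const _)]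
    simp [stableSemigroup]
  rw [h]
  exact enorm_integral_le_lintegral_enorm _

theorem IsStableLaw.eLpNorm_stableSemigroup_sub_le_sigmaNorm (hμ : IsStableLaw ν μ)
    (hν : IsNondegenerateSymmetricStable α ν) (hα : α ∈ Set.Ioo (1 : ℝ) 2)
    {Ω : Type*} [MeasurableSpace Ω] (P : Measure Ω) [IsProbabilityMeasure P] {Y : Ω → ℝ}
    (hY : AEMeasurable Y P)
    (hYc : ∀ ξ : ℝ, ∫ w, Complex.exp (Complex.I * ((ξ * Y w : ℝ) : ℂ)) ∂P =
        ((Real.exp (-(|ξ| ^ α)) : ℝ) : ℂ))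
    {p : ℝ} (hp : 1 ≤ p) {t : ℝ} (ht : 0 < t) {f : Rd d → ℝ} (hf : ContDiff ℝ 1 f)
    (hfc : HasCompactSupport f) :
    eLpNorm (fun x => stableSemigroup α μ t f x - f x) (ENNReal.ofReal p) volume ≤
      ENNReal.ofReal (t ^ (1 / α)) * (∫⁻ w, ENNReal.ofReal (|Y w| ^ p) ∂P) ^ (1 / p) *
        eLpNorm (fun x => sigmaNorm α ν (gradient f x)) (ENNReal.ofReal p) volume := by
  have := hμ.isProbabilityMeasure
  have hp0 : 0 < p := by linarith
  set τ := t ^ (1 / α) with hτ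
  have hτ0 : 0 < τ := by positivity
  have hc := hf.continuous_fderiv one_ne_zero
  set M := ∫⁻ w, ENNReal.ofReal (|Y w| ^ p) ∂P with hM
  have hMe : ∫⁻ w, ‖Y w‖ₑ ^ p ∂P = M := by
    refine lintegral_congr fun w => ?_
    rw [← ENNReal.ofReal_rpow_of_nonneg (abs_nonneg _) hp0.le, Real.enorm_eq_ofReal_abs]
  have hlaw : ∀ θ : Rd d, ∫⁻ y, ‖⟪y, θ⟫‖ₑ ^ p ∂μ = ‖sigmaNorm α ν θ‖ₑ ^ p * M := by
    intro θ
    have hm : Measurable fun r : ℝ => ‖r‖ₑ ^ p := by fun_prop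
    have h1 := lintegral_map (μ := μ) hm (show Measurable fun y : Rd d => ⟪y, θ⟫ by fun_prop)
    rw [← h1, hμ.map_inner_eq hν hα P hY hYc, lintegral_map' hm.aemeasurable (by fun_prop), ← hMe,
      ← lintegral_const_mul' _ _ (ENNReal.rpow_ne_top_of_nonneg hp0.le enorm_ne_top)]
    refine lintegral_congr fun w => ?_
    rw [enorm_mul, ENNReal.mul_rpow_of_nonneg _ _ hp0.le]
  have key : ∫⁻ x, ‖stableSemigroup α μ t f x - f x‖ₑ ^ p ≤
      ENNReal.ofReal τ ^ p * M * ∫⁻ x, ‖sigmaNorm α ν (gradient f x)‖ₑ ^ p := by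
    calc ∫⁻ x, ‖stableSemigroup α μ t f x - f x‖ₑ ^ p
        ≤ ∫⁻ x, (∫⁻ y, ‖f (x + τ • y) - f x‖ₑ ∂μ) ^ p :=
          lintegral_mono fun x => ENNReal.rpow_le_rpow
            (enorm_stableSemigroup_sub_le hf.continuous hfc t x) hp0.le
      _ ≤ ∫⁻ y, (∫⁻ x, ‖f (x + τ • y) - f x‖ₑ ^ p) ∂μ := by
          refine lintegral_rpow_lintegral_le volume μ hp (Continuous.measurable ?_)
          have := hf.continuous
          unfold Function.uncurry
          fun_prop
      _ ≤ ∫⁻ y, (∫⁻ x, ‖fderiv ℝ f x (τ • y)‖ₑ ^ p) ∂μ :=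
          lintegral_mono fun y => lintegral_enorm_translate_sub_rpow_le hf hp _
      -- With x fixed again, the y-integral is a p-th moment of ⟨y, ∇f(x)⟩ under μ, known from
      -- `hlaw`.
      _ = ∫⁻ x, ∫⁻ y, ‖fderiv ℝ f x (τ • y)‖ₑ ^ p ∂μ := by
          refine lintegral_lintegral_swap (Measurable.aemeasurable ?_)
          refine Measurable.pow_const (Continuous.measurable ?_) p
          fun_prop
      _ = ∫⁻ x, (ENNReal.ofReal τ ^ p * M) * ‖sigmaNorm α ν (gradient f x)‖ₑ ^ p := by
          refine lintegral_congr fun x => ?_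
          rw [mul_assoc, mul_comm M, ← hlaw, ← lintegral_const_mul' _ _
            (ENNReal.rpow_ne_top_of_nonneg hp0.le ENNReal.ofReal_ne_top)]
          refine lintegral_congr fun y => ?_
          rw [← ENNReal.mul_rpow_of_nonneg _ _ hp0.le, real_inner_comm, gradient,
            InnerProductSpace.toDual_symm_apply, map_smul, smul_eq_mul, enorm_mul,
            Real.enorm_of_nonneg hτ0.le]
      _ = _ := by
          rw [lintegral_const_mul]
          have hg : Measurable (gradient f) :=
            ((InnerProductSpace.toDual ℝ (Rd d)).symm.continuous.comp hc).measurable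
          have hs := (hν.toIsStableLevyMeasure.measurable_stableExponent.pow_const (1 / α)).comp hg
          exact Measurable.pow_const (Measurable.enorm hs) p
  rw [← ENNReal.rpow_le_rpow_iff hp0, ENNReal.mul_rpow_of_nonneg _ _ hp0.le,
    ENNReal.mul_rpow_of_nonneg _ _ hp0.le, ← ENNReal.rpow_mul, one_div_mul_cancel hp0.ne',
    ENNReal.rpow_one, eLpNorm_ofReal_rpow _ hp0, eLpNorm_ofReal_rpow _ hp0]
  exact key

/-! ### Fourier representation of test functions and decay of exp(-ψ) -/

open scoped FourierTransform in
theorem exists_fourier_representation {f : Rd d → ℝ} (hf : ContDiff ℝ ∞ f)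
    (hfc : HasCompactSupport f) :
    ∃ g : Rd d → ℂ, Continuous g ∧ (∀ n : ℕ, Integrable fun ξ => ‖ξ‖ ^ n * ‖g ξ‖) ∧
      ∀ x, (f x : ℂ) = ∫ ξ, Complex.exp (Complex.I * (⟪x, ξ⟫ : ℝ)) * g ξ := by
  have hF : ContDiff ℝ ∞ fun x => (f x : ℂ) := Complex.ofRealCLM.contDiff.comp hf
  have hFc : HasCompactSupport fun x => (f x : ℂ) :=
    hfc.comp_left (g := fun r : ℝ => (r : ℂ)) Complex.ofReal_zero
  set S : SchwartzMap (Rd d) ℂ := hFc.toSchwartzMap hF with hS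
  have hpi : (2 * Real.pi)⁻¹ ≠ 0 := by positivity
  have hpi' : 2 * Real.pi ≠ 0 := by positivity
  set c : ℝ := |((2 * Real.pi) ^ Module.finrank ℝ (Rd d))⁻¹| with hc
  -- The Fourier transform of f, rescaled to remove 2π from the phase; c is the Jacobian. Being
  -- Schwartz, it has all moments, which later absorb the growth of ψ and of |⟨u, ξ⟩|.
  refine ⟨fun ξ => (c : ℂ) * (𝓕 S) ((2 * Real.pi)⁻¹ • ξ), ?_, fun n => ?_, fun x => ?_⟩
  · have := (𝓕 S).continuous
    fun_prop
  · have h := ((𝓕 S).integrable_pow_mul volume n).comp_smul hpi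
    have h2 := h.const_mul (|c| * (2 * Real.pi) ^ n)
    refine h2.congr (Filter.Eventually.of_forall fun ξ => ?_)
    have hq : (2 * Real.pi) ^ n * (2 * Real.pi)⁻¹ ^ n = 1 := by
      rw [← mul_pow, mul_inv_cancel₀ hpi', one_pow]
    simp only [norm_mul, norm_smul, Complex.norm_real, Real.norm_eq_abs]
    rw [show |(2 * Real.pi)⁻¹| = (2 * Real.pi)⁻¹ from abs_of_pos (by positivity),
      mul_pow _ ‖ξ‖]
    linear_combination (|c| * ‖ξ‖ ^ n * ‖(𝓕 S) ((2 * Real.pi)⁻¹ • ξ)‖) * hq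
  · have hinv : 𝓕⁻ (𝓕 S) x = S x := by rw [FourierTransform.fourierInv_fourier_eq]
    have hSx : S x = (f x : ℂ) := rfl
    rw [← hSx, ← hinv, SchwartzMap.fourierInv_coe, Real.fourierInv_eq']
    have h := Measure.integral_comp_smul (volume : Measure (Rd d))
      (fun ξ => Complex.exp (Complex.I * (⟪x, ξ⟫ : ℝ)) * (𝓕 S) ((2 * Real.pi)⁻¹ • ξ))
      (2 * Real.pi)
    simp only [smul_smul, inv_mul_cancel₀ hpi', one_smul, inner_smul_right] at h
    rw [← hc, ← integral_smul] at h
    refine Eq.trans (integral_congr_ae (Filter.Eventually.of_forall fun ξ => ?_))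
      (h.trans (integral_congr_ae (Filter.Eventually.of_forall fun ξ => ?_)))
    · simp only [smul_eq_mul]
      rw [real_inner_comm, mul_comm Complex.I]
    · simp only [Complex.real_smul]
      ring

theorem IsNondegenerateSymmetricStable.exists_exp_neg_stableExponent_le
    (hν : IsNondegenerateSymmetricStable α ν) (hα : 1 ≤ α) (N : ℕ) :
    ∃ C, ∀ ξ : Rd d, Real.exp (-stableExponent α ν ξ) ≤ C * ((1 + ‖ξ‖) ^ N)⁻¹ := by
  obtain ⟨c, hc, hle⟩ := hν.exists_le_stableExponent (by linarith)
  -- From ψ ≥ c‖ξ‖^α ≥ c(‖ξ‖ - 1) = c(1 + ‖ξ‖) - 2c, followed by exp(x) ≥ x^N/N!.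
  refine ⟨Real.exp (2 * c) * N.factorial * (c ^ N)⁻¹, fun ξ => ?_⟩
  have hξ := norm_nonneg ξ
  have h1 : ‖ξ‖ - 1 ≤ ‖ξ‖ ^ α := by
    rcases le_total ‖ξ‖ 1 with h | h
    · have : 0 ≤ ‖ξ‖ ^ α := by positivity
      linarith
    · have := Real.rpow_le_rpow_of_exponent_le h hα
      rw [Real.rpow_one] at this
      linarith
  have h2 : -stableExponent α ν ξ ≤ 2 * c + -(c * (1 + ‖ξ‖)) := by
    nlinarith [hle ξ, mul_le_mul_of_nonneg_left h1 hc.le]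
  have h3 := Real.pow_div_factorial_le_exp (c * (1 + ‖ξ‖)) (by positivity) N
  calc Real.exp (-stableExponent α ν ξ) ≤ Real.exp (2 * c + -(c * (1 + ‖ξ‖))) :=
        Real.exp_le_exp.2 h2
    _ = Real.exp (2 * c) * (Real.exp (c * (1 + ‖ξ‖)))⁻¹ := by rw [Real.exp_add, Real.exp_neg]
    _ ≤ Real.exp (2 * c) * ((c * (1 + ‖ξ‖)) ^ N / N.factorial)⁻¹ := by gcongr
    _ = _ := by
        rw [mul_pow, inv_div]
        field_simp

theorem IsNondegenerateSymmetricStable.integrable_norm_pow_mul_exp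
    (hν : IsNondegenerateSymmetricStable α ν) (hα : 1 ≤ α) (n : ℕ) :
    Integrable fun ξ : Rd d => ‖ξ‖ ^ n * Real.exp (-stableExponent α ν ξ) := by
  obtain ⟨C, hC⟩ := hν.exists_exp_neg_stableExponent_le hα (n + (d + 1))
  have hm := hν.toIsStableLevyMeasure.measurable_stableExponent
  have h := (integrable_one_add_norm (E := Rd d) (μ := volume) (r := d + 1)
    (by simp)).const_mul C
  refine h.mono' (Measurable.aestronglyMeasurable (by fun_prop))
    (Filter.Eventually.of_forall fun ξ => ?_)
  rw [Real.norm_of_nonneg (by positivity)]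
  have hξ := norm_nonneg ξ
  calc ‖ξ‖ ^ n * Real.exp (-stableExponent α ν ξ)
      ≤ (1 + ‖ξ‖) ^ n * (C * ((1 + ‖ξ‖) ^ (n + (d + 1)))⁻¹) := by
        gcongr
        · linarith
        · exact hC ξ
    _ = _ := by
        rw [Real.rpow_neg (by positivity), show ((d : ℝ) + 1) = ((d + 1 : ℕ) : ℝ) by push_cast; rfl,
          Real.rpow_natCast, pow_add]
        field_simp

/-! ### Regularity of the density and integration by parts -/

theorem IsLebesgueDensity.integral_eq (hp : IsLebesgueDensity μ pα) {E : Type*}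
    [NormedAddCommGroup E] [NormedSpace ℝ E] (F : Rd d → E) :
    ∫ y, F y ∂μ = ∫ y, pα y • F y := by
  have hm := hp.continuous.measurable
  rw [hp.eq_withDensity, integral_withDensity_eq_integral_toReal_smul (by fun_prop) (by simp)]
  simp [ENNReal.toReal_ofReal (hp.nonneg _)]

theorem IsLebesgueDensity.lintegral_eq (hp : IsLebesgueDensity μ pα) {F : Rd d → ENNReal}
    (hF : Measurable F) : ∫⁻ y, F y ∂μ = ∫⁻ y, ENNReal.ofReal (pα y) * F y := by
  have hm := hp.continuous.measurable
  rw [hp.eq_withDensity, lintegral_withDensity_eq_lintegral_mul _ (by fun_prop) hF]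
  rfl

theorem IsLebesgueDensity.integrable [IsFiniteMeasure μ] (hp : IsLebesgueDensity μ pα) :
    Integrable pα := by
  refine ⟨hp.continuous.aestronglyMeasurable, ?_⟩
  rw [hasFiniteIntegral_iff_ofReal (Filter.Eventually.of_forall hp.nonneg)]
  have h := hp.lintegral_eq (F := fun _ => 1) measurable_const
  simp only [lintegral_const, one_mul, mul_one] at h
  rw [← h]
  exact measure_lt_top _ _

theorem IsLebesgueDensity.integral_cexp_mul (hp : IsLebesgueDensity μ pα) (ξ : Rd d) :
    ∫ y, Complex.exp (Complex.I * (⟪y, ξ⟫ : ℝ)) * (pα y : ℂ) = charFun μ ξ := by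
  rw [charFun_apply, hp.integral_eq]
  refine integral_congr_ae (Filter.Eventually.of_forall fun y => ?_)
  simp only [Complex.real_smul, mul_comm]

-- Non-degeneracy makes exp(-ψ) decay faster than any power. Inversion holds at every point because
-- p is continuous, and exhibits p as the Fourier transform of a function with finite moments.
open scoped FourierTransform in
theorem IsLebesgueDensity.contDiff (hp : IsLebesgueDensity μ pα) (hμ : IsStableLaw ν μ)
    (hν : IsNondegenerateSymmetricStable α ν) (hα : α ∈ Set.Ioo (1 : ℝ) 2) :
    ContDiff ℝ 1 pα := by
  have := hμ.isProbabilityMeasure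
  have hpi : 2 * Real.pi ≠ 0 := by positivity
  set P : Rd d → ℂ := fun y => (pα y : ℂ) with hP
  have hPc : Continuous P := Complex.continuous_ofReal.comp hp.continuous
  have hPi : Integrable P := hp.integrable.ofReal
  have hFP : 𝓕 P = fun ξ =>
      ((Real.exp (-stableExponent α ν ((2 * Real.pi) • ξ)) : ℝ) : ℂ) := by
    ext ξ
    have h := hp.integral_cexp_mul ((-(2 * Real.pi)) • ξ)
    -- The sign of the Fourier convention is harmless since ψ is even.
    rw [hμ.charFun_eq hν hα, stableExponent_smul, abs_neg, ← stableExponent_smul] at h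
    rw [← h, Real.fourier_eq']
    refine integral_congr_ae (Filter.Eventually.of_forall fun y => ?_)
    simp only [smul_eq_mul, inner_smul_right, hP, mul_comm Complex.I, neg_mul]
  have hint : ∀ n : ℕ, Integrable fun ξ => ‖ξ‖ ^ n * ‖𝓕 P ξ‖ := by
    intro n
    have h := ((hν.integrable_norm_pow_mul_exp hα.1.le n).comp_smul hpi).const_mul
      (((2 * Real.pi) ^ n)⁻¹)
    refine h.congr (Filter.Eventually.of_forall fun ξ => ?_)
    simp only [hFP, Complex.norm_real, Real.norm_eq_abs, abs_of_pos (Real.exp_pos _), norm_smul,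
      abs_of_pos (show 0 < 2 * Real.pi by positivity), mul_pow]
    field_simp
  have hFi : Integrable (𝓕 P) := by
    have hm := hν.toIsStableLevyMeasure.measurable_stableExponent
    have h := hint 0
    simp only [pow_zero, one_mul] at h
    refine (integrable_norm_iff ?_).1 h
    rw [hFP]
    exact Measurable.aestronglyMeasurable (by fun_prop)
  have hinv : ∀ y, pα y = (𝓕 (𝓕 P) (-y)).re := by
    intro y
    rw [← Real.fourierInv_eq_fourier_neg, hPc.fourierInv_fourier_eq hPi hFi]
    simp [hP]
  have hcd : ContDiff ℝ 1 (𝓕 (𝓕 P)) :=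
    Real.contDiff_fourier (N := 1) fun n _ => hint n
  rw [funext hinv]
  exact Complex.reCLM.contDiff.comp (hcd.comp contDiff_neg)

/-- Positivity of p is not needed: at a zero of p, which is a minimum, the gradient vanishes and
both sides are 0. -/
theorem IsLebesgueDensity.gradient_eq (hp : IsLebesgueDensity μ pα) (x : Rd d) :
    gradient pα x = pα x • logDerivative pα x := by
  rcases eq_or_ne (pα x) 0 with h0 | h0
  · have hmin : IsLocalMin pα x :=
      Filter.Eventually.of_forall fun y => by rw [h0]; exact hp.nonneg y
    simp [h0, gradient, hmin.fderiv_eq_zero]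
  · rw [logDerivative, smul_smul, mul_inv_cancel₀ h0, one_smul]

theorem fderiv_apply_eq_inner_gradient (p : Rd d → ℝ) (y u : Rd d) :
    fderiv ℝ p y u = ⟪gradient p y, u⟫ := by
  rw [gradient, InnerProductSpace.toDual_symm_apply]

theorem measurable_gradient (p : Rd d → ℝ) : Measurable (gradient p) :=
  (InnerProductSpace.toDual ℝ (Rd d)).symm.continuous.measurable.comp (measurable_fderiv ℝ p)

theorem IsLebesgueDensity.measurable_logDerivative (hp : IsLebesgueDensity μ pα) :
    Measurable (logDerivative pα) :=
  hp.continuous.measurable.inv.smul (measurable_gradient pα)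

theorem IsLebesgueDensity.integrable_gradient (hp : IsLebesgueDensity μ pα)
    (hlog : eLpNorm (logDerivative pα) 1 μ < ⊤) : Integrable (gradient pα) := by
  refine ⟨(measurable_gradient pα).aestronglyMeasurable, ?_⟩
  rw [eLpNorm_one_eq_lintegral_enorm, hp.lintegral_eq hp.measurable_logDerivative.enorm] at hlog
  refine lt_of_le_of_lt (le_of_eq (lintegral_congr fun y => ?_)) hlog
  rw [hp.gradient_eq, enorm_smul, Real.enorm_of_nonneg (hp.nonneg y)]

/-- Integration by parts; there is no boundary term, since the products involved are integrable. It
uses that p and ∇p are integrable and that the exponential has modulus one. -/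
theorem IsLebesgueDensity.integral_cexp_mul_inner_gradient (hp : IsLebesgueDensity μ pα)
    (hμ : IsStableLaw ν μ) (hν : IsNondegenerateSymmetricStable α ν)
    (hα : α ∈ Set.Ioo (1 : ℝ) 2) (hg : Integrable (gradient pα)) (ξ u : Rd d) :
    ∫ y, Complex.exp (Complex.I * (⟪y, ξ⟫ : ℝ)) * (⟪gradient pα y, u⟫ : ℝ) =
      -(Complex.I * (⟪u, ξ⟫ : ℝ)) * (Real.exp (-stableExponent α ν ξ) : ℝ) := by
  have := hμ.isProbabilityMeasure
  have hpd : Differentiable ℝ pα := (hp.contDiff hμ hν hα).differentiable one_ne_zero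
  have hP : ∀ y, HasFDerivAt (fun y => (pα y : ℂ)) (Complex.ofRealCLM.comp (fderiv ℝ pα y)) y :=
    fun y => Complex.ofRealCLM.hasFDerivAt.comp y (hpd y).hasFDerivAt
  have he : ∀ y : Rd d, HasFDerivAt (fun y : Rd d => Complex.exp (Complex.I * (⟪y, ξ⟫ : ℝ)))
      (Complex.exp (Complex.I * (⟪y, ξ⟫ : ℝ)) • (Complex.I • Complex.ofRealCLM.comp
        ((innerSL ℝ) ξ))) y := by
    intro y
    have h1 : HasFDerivAt (fun y : Rd d => ((⟪y, ξ⟫ : ℝ) : ℂ))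
        (Complex.ofRealCLM.comp ((innerSL ℝ) ξ)) y := by
      have h0 : HasFDerivAt (fun y : Rd d => ⟪y, ξ⟫) ((innerSL ℝ) ξ) y := by
        simp only [real_inner_comm ξ]
        exact ((innerSL ℝ) ξ).hasFDerivAt
      exact Complex.ofRealCLM.hasFDerivAt.comp y h0
    exact (h1.const_mul Complex.I).cexp
  have hfe : ∀ y, fderiv ℝ (fun y : Rd d => Complex.exp (Complex.I * (⟪y, ξ⟫ : ℝ))) y u =
      Complex.I * (⟪u, ξ⟫ : ℝ) * Complex.exp (Complex.I * (⟪y, ξ⟫ : ℝ)) := by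
    intro y
    rw [(he y).fderiv]
    simp [real_inner_comm]
    ring
  have hfP : ∀ y, fderiv ℝ (fun y => (pα y : ℂ)) y u = (⟪gradient pα y, u⟫ : ℝ) := by
    intro y
    rw [(hP y).fderiv, ← fderiv_apply_eq_inner_gradient]
    rfl
  have hb : ∀ y : Rd d, ‖Complex.exp (Complex.I * (⟪y, ξ⟫ : ℝ))‖ ≤ 1 :=
    fun y => (Complex.norm_exp_I_mul_ofReal _).le
  have i1 : Integrable fun y : Rd d =>
      Complex.exp (Complex.I * (⟪y, ξ⟫ : ℝ)) * (pα y : ℂ) :=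
    hp.integrable.ofReal.bdd_mul (c := 1) (by fun_prop) (Filter.Eventually.of_forall hb)
  have i2 : Integrable fun y : Rd d =>
      Complex.exp (Complex.I * (⟪y, ξ⟫ : ℝ)) * ((⟪gradient pα y, u⟫ : ℝ) : ℂ) :=
    (hg.inner_const u).ofReal.bdd_mul (c := 1) (by fun_prop) (Filter.Eventually.of_forall hb)
  have h := integral_mul_fderiv_eq_neg_fderiv_mul_of_integrable (𝕜 := ℂ)
    (μ := (volume : Measure (Rd d)))
    (f := fun y : Rd d => Complex.exp (Complex.I * (⟪y, ξ⟫ : ℝ)))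
    (g := fun y => (pα y : ℂ)) (v := u)
    (by simp only [hfe, mul_assoc]; exact (i1.const_mul _).const_mul _)
    (by simpa only [hfP] using i2) i1 (fun y _ => (he y).differentiableAt)
    (fun y _ => (hP y).differentiableAt)
  simp only [hfe, hfP] at h
  rw [h]
  simp only [mul_assoc]
  rw [integral_const_mul, integral_const_mul, hp.integral_cexp_mul, hμ.charFun_eq hν hα]
  ring

/-! ### The fractional gradient tested against ∇p -/

theorem exists_abs_sub_mul_norm_le (hf : ContDiff ℝ 1 f) (hfc : HasCompactSupport f) :
    ∃ C, ∀ x u, |f (x + u) - f x| * ‖u‖ ≤ C * min ‖u‖ (‖u‖ ^ 2) := by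
  obtain ⟨B, hB⟩ := hfc.exists_bound_of_continuous hf.continuous
  obtain ⟨K, hK⟩ := hf.lipschitzWith_of_hasCompactSupport hfc one_ne_zero
  refine ⟨2 * B + K, fun x u => ?_⟩
  have hu := norm_nonneg u
  have hB0 : 0 ≤ B := (norm_nonneg _).trans (hB 0)
  have h1 : |f (x + u) - f x| ≤ 2 * B := by
    have := norm_sub_le (f (x + u)) (f x)
    rw [Real.norm_eq_abs] at this
    linarith [hB (x + u), hB x]
  have h2 : |f (x + u) - f x| ≤ K * ‖u‖ := by
    have := hK.dist_le_mul (x + u) x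
    simpa [Real.dist_eq] using this
  have hK0 : (0 : ℝ) ≤ K := K.2
  rcases min_cases ‖u‖ (‖u‖ ^ 2) with ⟨h, -⟩ | ⟨h, -⟩ <;> rw [h]
  · nlinarith [mul_nonneg hK0 hu]
  · nlinarith [mul_nonneg hB0 (sq_nonneg ‖u‖)]

theorem IsStableLevyMeasure.integrable_fracGradient (hν : IsStableLevyMeasure α ν)
    (hα : α ∈ Set.Ioo (1 : ℝ) 2) (hf : ContDiff ℝ 1 f) (hfc : HasCompactSupport f) (x : Rd d) :
    Integrable (fun u => (f (x + u) - f x) • u) ν := by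
  obtain ⟨C, hC⟩ := exists_abs_sub_mul_norm_le hf hfc
  have := hf.continuous
  refine ((hν.integrable_min_norm hα).const_mul C).mono' (by fun_prop)
    (Filter.Eventually.of_forall fun u => ?_)
  rw [norm_smul, Real.norm_eq_abs]
  exact hC x u

theorem IsStableLevyMeasure.stronglyMeasurable_fracGradient (hν : IsStableLevyMeasure α ν)
    (hf : Continuous f) : StronglyMeasurable (fracGradient ν f) := by
  have := hν.sFinite
  have h : StronglyMeasurable (Function.uncurry fun (x u : Rd d) => (f (x + u) - f x) • u) := by
    refine Continuous.stronglyMeasurable ?_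
    unfold Function.uncurry
    fun_prop
  exact h.integral_prod_right

theorem IsStableLevyMeasure.inner_fracGradient (hν : IsStableLevyMeasure α ν)
    (hα : α ∈ Set.Ioo (1 : ℝ) 2) (hf : ContDiff ℝ 1 f) (hfc : HasCompactSupport f)
    (x v : Rd d) :
    ⟪fracGradient ν f x, v⟫ = ∫ u, (f (x + u) - f x) * ⟪v, u⟫ ∂ν := by
  rw [real_inner_comm, fracGradient, ← integral_inner (hν.integrable_fracGradient hα hf hfc x)]
  simp only [inner_smul_right]

/-- Fubini, placing the ν-integral outermost: for fixed u only increments of f remain, and these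
have an explicit Fourier expansion. -/
theorem IsStableLevyMeasure.integral_inner_fracGradient_eq (hν : IsStableLevyMeasure α ν)
    (hα : α ∈ Set.Ioo (1 : ℝ) 2) (hf : ContDiff ℝ 1 f) (hfc : HasCompactSupport f)
    {G : Rd d → Rd d} (hG : Integrable G) (τ : ℝ) (x : Rd d) :
    ∫ y, ⟪fracGradient ν f (x + τ • y), G y⟫ =
      ∫ u, (∫ y, (f (x + τ • y + u) - f (x + τ • y)) * ⟪G y, u⟫) ∂ν := by
  have := hν.sFinite
  obtain ⟨C, hC⟩ := exists_abs_sub_mul_norm_le hf hfc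
  have hfc' := hf.continuous
  simp only [hν.inner_fracGradient hα hf hfc]
  refine integral_integral_swap (f := fun y u =>
    (f (x + τ • y + u) - f (x + τ • y)) * ⟪G y, u⟫) ?_
  refine (hG.norm.mul_prod ((hν.integrable_min_norm hα).const_mul C)).mono' ?_
    (Filter.Eventually.of_forall fun z => ?_)
  · unfold Function.uncurry
    refine AEStronglyMeasurable.mul (Continuous.aestronglyMeasurable (by fun_prop)) ?_
    exact (hG.aestronglyMeasurable.comp_fst).inner (by fun_prop)
  · simp only [Function.uncurry, norm_mul, Real.norm_eq_abs]
    have h1 := hC (x + τ • z.1) z.2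
    have h2 := abs_real_inner_le_norm (G z.1) z.2
    calc |f (x + τ • z.1 + z.2) - f (x + τ • z.1)| * |⟪G z.1, z.2⟫|
        ≤ |f (x + τ • z.1 + z.2) - f (x + τ • z.1)| * (‖G z.1‖ * ‖z.2‖) := by gcongr
      _ = ‖G z.1‖ * (|f (x + τ • z.1 + z.2) - f (x + τ • z.1)| * ‖z.2‖) := by ring
      _ ≤ _ := by gcongr

/-- Expand the increment of f in frequencies and exchange. The y-integral is then the transform of
∇p at τξ, which gives exp(-ψ(τξ)) and the factor -iτ⟨u, ξ⟩. -/
theorem IsLebesgueDensity.integral_sub_mul_inner_gradient (hp : IsLebesgueDensity μ pα)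
    (hμ : IsStableLaw ν μ) (hν : IsNondegenerateSymmetricStable α ν)
    (hα : α ∈ Set.Ioo (1 : ℝ) 2) (hG : Integrable (gradient pα)) {g : Rd d → ℂ}
    (hg : Integrable g) (hfg : ∀ x, (f x : ℂ) = ∫ ξ, Complex.exp (Complex.I * (⟪x, ξ⟫ : ℝ)) * g ξ)
    (τ : ℝ) (x u : Rd d) :
    ((∫ y, (f (x + τ • y + u) - f (x + τ • y)) * ⟪gradient pα y, u⟫ : ℝ) : ℂ) =
      ∫ ξ, (Complex.exp (Complex.I * (⟪x, ξ⟫ : ℝ)) * g ξ *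
        (Real.exp (-stableExponent α ν (τ • ξ)) : ℝ) * (-(τ : ℂ))) *
        (Complex.I * (⟪u, ξ⟫ : ℝ) * (Complex.exp (Complex.I * (⟪u, ξ⟫ : ℝ)) - 1)) := by
  have hb : ∀ r : ℝ, ‖Complex.exp (Complex.I * r)‖ ≤ 1 :=
    fun y => (Complex.norm_exp_I_mul_ofReal _).le
  have hgi : ∀ x : Rd d, Integrable fun ξ => Complex.exp (Complex.I * (⟪x, ξ⟫ : ℝ)) * g ξ :=
    fun x => hg.bdd_mul (c := 1) (by fun_prop) (Filter.Eventually.of_forall fun ξ => hb _)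
  set A : Rd d → ℂ := fun ξ => Complex.exp (Complex.I * (⟪x, ξ⟫ : ℝ)) *
    (Complex.exp (Complex.I * (⟪u, ξ⟫ : ℝ)) - 1) * g ξ with hA
  have hAi : Integrable A := by
    refine hg.bdd_mul (c := 2) (by fun_prop) (Filter.Eventually.of_forall fun ξ => ?_)
    rw [norm_mul, Complex.norm_exp_I_mul_ofReal, one_mul]
    refine (norm_sub_le _ _).trans ?_
    rw [Complex.norm_exp_I_mul_ofReal]
    norm_num
  have hdiff : ∀ y, ((f (x + τ • y + u) - f (x + τ • y) : ℝ) : ℂ) =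
      ∫ ξ, Complex.exp (Complex.I * (⟪y, τ • ξ⟫ : ℝ)) * A ξ := by
    intro y
    rw [Complex.ofReal_sub, hfg, hfg, ← integral_sub (hgi _) (hgi _)]
    refine integral_congr_ae (Filter.Eventually.of_forall fun ξ => ?_)
    simp only [hA, inner_add_left, inner_smul_left, inner_smul_right, Complex.ofReal_add, mul_add,
      Complex.exp_add, conj_trivial]
    ring
  rw [← integral_complex_ofReal]
  simp only [Complex.ofReal_mul, hdiff, ← integral_mul_const]
  rw [integral_integral_swap (f := fun y ξ => Complex.exp (Complex.I * (⟪y, τ • ξ⟫ : ℝ)) * A ξ *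
    ((⟪gradient pα y, u⟫ : ℝ) : ℂ))]
  · refine integral_congr_ae (Filter.Eventually.of_forall fun ξ => ?_)
    have h := hp.integral_cexp_mul_inner_gradient hμ hν hα hG (τ • ξ) u
    simp only [mul_right_comm _ (A ξ)]
    rw [integral_mul_const, h, inner_smul_right]
    simp only [hA]
    push_cast
    ring
  · have h := ((hG.inner_const u).ofReal (𝕜 := ℂ)).mul_prod hAi
    refine (h.bdd_mul (c := 1)
      (f := fun z : Rd d × Rd d => Complex.exp (Complex.I * (⟪z.1, τ • z.2⟫ : ℝ)))
      (by fun_prop) (Filter.Eventually.of_forall fun ξ => hb _)).congr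
      (Filter.Eventually.of_forall fun z => ?_)
    simp only [Function.uncurry, mul_assoc]
    rw [mul_comm (A z.2)]
    rfl

/-- Exchanging once more leaves for each ξ the ν-integral of Euler's identity, -αψ(ξ); its sign
cancels that of -τ. -/
theorem IsLebesgueDensity.integral_inner_fracGradient (hp : IsLebesgueDensity μ pα)
    (hμ : IsStableLaw ν μ) (hν : IsNondegenerateSymmetricStable α ν)
    (hα : α ∈ Set.Ioo (1 : ℝ) 2) (hG : Integrable (gradient pα))
    (hf : ContDiff ℝ 1 f) (hfc : HasCompactSupport f) {g : Rd d → ℂ}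
    (hgm : AEStronglyMeasurable g) (hgi : ∀ n : ℕ, Integrable fun ξ => ‖ξ‖ ^ n * ‖g ξ‖)
    (hfg : ∀ x, (f x : ℂ) = ∫ ξ, Complex.exp (Complex.I * (⟪x, ξ⟫ : ℝ)) * g ξ)
    (τ : ℝ) (x : Rd d) :
    ((∫ y, ⟪fracGradient ν f (x + τ • y), gradient pα y⟫ : ℝ) : ℂ) =
      (α * τ : ℝ) * ∫ ξ, Complex.exp (Complex.I * (⟪x, ξ⟫ : ℝ)) * g ξ *
        (stableExponent α ν ξ * Real.exp (-stableExponent α ν (τ • ξ)) : ℝ) := by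
  have hν' := hν.toIsStableLevyMeasure
  have := hν'.sFinite
  have hm := hν'.measurable_stableExponent
  have hg : Integrable g := by
    have h := hgi 0
    simp only [pow_zero, one_mul] at h
    exact (integrable_norm_iff hgm).1 h
  rw [hν'.integral_inner_fracGradient_eq hα hf hfc hG, ← integral_complex_ofReal]
  simp only [hp.integral_sub_mul_inner_gradient hμ hν hα hG hg hfg]
  rw [integral_integral_swap, ← integral_const_mul]
  · refine integral_congr_ae (Filter.Eventually.of_forall fun ξ => ?_)
    simp only
    rw [integral_const_mul, hν.integral_mul_cexp_sub_one hα]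
    push_cast
    ring
  -- The moments of order 1 and 2 of g come from the factor ‖ξ‖ + ‖ξ‖² in `min_abs_inner_le`.
  · have h := (((hν'.integrable_min_norm hα).const_mul (2 * |τ|))).mul_prod
      ((hgi 1).add (hgi 2))
    refine h.mono' ?_ (Filter.Eventually.of_forall fun z => ?_)
    · unfold Function.uncurry
      refine AEStronglyMeasurable.mul ?_ (Continuous.aestronglyMeasurable (by fun_prop))
      refine AEStronglyMeasurable.mul (AEStronglyMeasurable.mul (AEStronglyMeasurable.mul
        (Continuous.aestronglyMeasurable (by fun_prop)) hgm.comp_snd)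
        (Measurable.aestronglyMeasurable (by fun_prop))) (by fun_prop)
    · have h1 := norm_mul_cexp_sub_one_le ⟪z.1, z.2⟫ 1 (by norm_num)
      have h2 := min_abs_inner_le z.1 z.2
      have h3 : Real.exp (-stableExponent α ν (τ • z.2)) ≤ 1 :=
        Real.exp_le_one_iff.2 (by linarith [stableExponent_nonneg (α := α) (ν := ν) (τ • z.2)])
      rw [one_mul] at h1
      have h4 := h1.trans (mul_le_mul_of_nonneg_left h2 zero_le_two)
      have h5 : ‖Complex.exp (Complex.I * (⟪x, z.2⟫ : ℝ)) * g z.2 *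
          (Real.exp (-stableExponent α ν (τ • z.2)) : ℝ) * (-(τ : ℂ))‖ ≤ ‖g z.2‖ * 1 * |τ| := by
        simp only [norm_mul, norm_neg, Complex.norm_real, Complex.norm_exp_I_mul_ofReal, one_mul,
          Real.norm_eq_abs, Real.abs_exp]
        gcongr
      simp only [Function.uncurry]
      rw [norm_mul]
      refine (mul_le_mul h5 h4 (norm_nonneg _) (by positivity)).trans_eq ?_
      simp only [Pi.add_apply]
      ring

/-! ### The semigroup as a Fourier multiplier and the estimate by D^{α-1}f -/

theorem IsStableLaw.stableSemigroup_eq (hμ : IsStableLaw ν μ)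
    (hν : IsNondegenerateSymmetricStable α ν) (hα : α ∈ Set.Ioo (1 : ℝ) 2) {g : Rd d → ℂ}
    (hg : Integrable g) (hfg : ∀ x, (f x : ℂ) = ∫ ξ, Complex.exp (Complex.I * (⟪x, ξ⟫ : ℝ)) * g ξ)
    {t : ℝ} (x : Rd d) :
    (stableSemigroup α μ t f x : ℂ) =
      ∫ ξ, Complex.exp (Complex.I * (⟪x, ξ⟫ : ℝ)) * g ξ *
        (Real.exp (-stableExponent α ν (t ^ (1 / α) • ξ)) : ℝ) := by
  have := hμ.isProbabilityMeasure
  set τ := t ^ (1 / α) with hτ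
  set A : Rd d → ℂ := fun ξ => Complex.exp (Complex.I * (⟪x, ξ⟫ : ℝ)) * g ξ with hA
  have hb : ∀ r : ℝ, ‖Complex.exp (Complex.I * r)‖ ≤ 1 :=
    fun y => (Complex.norm_exp_I_mul_ofReal _).le
  have hAi : Integrable A :=
    hg.bdd_mul (c := 1) (by fun_prop) (Filter.Eventually.of_forall fun ξ => hb _)
  have hx : ∀ y, (f (x + τ • y) : ℂ) =
      ∫ ξ, Complex.exp (Complex.I * (⟪y, τ • ξ⟫ : ℝ)) * A ξ := by
    intro y
    rw [hfg]
    refine integral_congr_ae (Filter.Eventually.of_forall fun ξ => ?_)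
    simp only [hA, inner_add_left, inner_smul_left, inner_smul_right, Complex.ofReal_add, mul_add,
      Complex.exp_add, conj_trivial]
    ring
  rw [stableSemigroup, ← integral_complex_ofReal]
  simp only [← hτ, hx]
  rw [integral_integral_swap]
  · refine integral_congr_ae (Filter.Eventually.of_forall fun ξ => ?_)
    have h := hμ.charFun_eq hν hα (τ • ξ)
    simp only [charFun_apply, mul_comm _ Complex.I] at h
    simp only
    rw [integral_mul_const, h, mul_comm]
  · have h := (integrable_const (μ := μ) (1 : ℂ)).mul_prod hAi
    refine (h.bdd_mul (c := 1)
      (f := fun z : Rd d × Rd d => Complex.exp (Complex.I * (⟪z.1, τ • z.2⟫ : ℝ)))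
      (by fun_prop) (Filter.Eventually.of_forall fun ξ => hb _)).congr
      (Filter.Eventually.of_forall fun z => ?_)
    simp only [Function.uncurry, one_mul]

theorem stableExponent_rpow_smul (hα : 0 < α) {t : ℝ} (ht : 0 ≤ t) (ξ : Rd d) :
    stableExponent α ν (t ^ (1 / α) • ξ) = t * stableExponent α ν ξ := by
  rw [stableExponent_smul, abs_of_nonneg (by positivity), ← Real.rpow_mul ht,
    one_div_mul_cancel hα.ne', Real.rpow_one]

theorem integral_Ioc_mul_exp_neg_mul (b : ℝ) {t : ℝ} (ht : 0 ≤ t) :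
    ∫ s in Set.Ioc 0 t, b * Real.exp (-(s * b)) = 1 - Real.exp (-(t * b)) := by
  have hd : ∀ s : ℝ,
      HasDerivAt (fun s : ℝ => -Real.exp (-(s * b))) (b * Real.exp (-(s * b))) s := by
    intro s
    have h := (((hasDerivAt_id s).mul_const b).neg.exp).neg
    refine h.congr_deriv ?_
    simp
    ring
  have h := intervalIntegral.integral_eq_sub_of_hasDerivAt (fun s _ => hd s)
    (Continuous.intervalIntegrable (by fun_prop) 0 t)
  rw [← intervalIntegral.integral_of_le ht, h]
  simp
  ring

/-- The multiplier 1 - exp(-tψ) is the integral of ψ exp(-sψ) over (0, t], and sψ(ξ) = ψ(s^(1/α) ξ)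
by homogeneity. -/
theorem IsStableLaw.stableSemigroup_sub_eq (hμ : IsStableLaw ν μ)
    (hν : IsNondegenerateSymmetricStable α ν) (hα : α ∈ Set.Ioo (1 : ℝ) 2) {g : Rd d → ℂ}
    (hgm : AEStronglyMeasurable g) (hgi : ∀ n : ℕ, Integrable fun ξ => ‖ξ‖ ^ n * ‖g ξ‖)
    (hfg : ∀ x, (f x : ℂ) = ∫ ξ, Complex.exp (Complex.I * (⟪x, ξ⟫ : ℝ)) * g ξ)
    {t : ℝ} (ht : 0 ≤ t) (x : Rd d) :
    ((f x - stableSemigroup α μ t f x : ℝ) : ℂ) =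
      ∫ s in Set.Ioc 0 t, ∫ ξ, Complex.exp (Complex.I * (⟪x, ξ⟫ : ℝ)) * g ξ *
        (stableExponent α ν ξ * Real.exp (-stableExponent α ν (s ^ (1 / α) • ξ)) : ℝ) := by
  have hα0 : 0 < α := by linarith [hα.1]
  have hν' := hν.toIsStableLevyMeasure
  have hm := hν'.measurable_stableExponent
  obtain ⟨C, hC⟩ := hν'.exists_stableExponent_le hα0
  have hg : Integrable g := by
    have h := hgi 0
    simp only [pow_zero, one_mul] at h
    exact (integrable_norm_iff hgm).1 h
  have hb : ∀ r : ℝ, ‖Complex.exp (Complex.I * r)‖ ≤ 1 :=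
    fun y => (Complex.norm_exp_I_mul_ofReal _).le
  set A : Rd d → ℂ := fun ξ => Complex.exp (Complex.I * (⟪x, ξ⟫ : ℝ)) * g ξ with hA
  have hAi : Integrable A :=
    hg.bdd_mul (c := 1) (by fun_prop) (Filter.Eventually.of_forall fun ξ => hb _)
  have hAn : ∀ ξ, ‖A ξ‖ = ‖g ξ‖ := fun ξ => by
    simp only [hA, norm_mul, Complex.norm_exp_I_mul_ofReal, one_mul]
  have hexp : ∀ r : ℝ, 0 ≤ r → ∀ ξ : Rd d, Real.exp (-(r * stableExponent α ν ξ)) ≤ 1 :=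
    fun r hr ξ => Real.exp_le_one_iff.2
      (by linarith [mul_nonneg hr (stableExponent_nonneg (α := α) (ν := ν) ξ)])
  have hAe : Integrable fun ξ => A ξ * (Real.exp (-(t * stableExponent α ν ξ)) : ℝ) := by
    refine hAi.mul_bdd (c := 1) (Measurable.aestronglyMeasurable (by fun_prop))
      (Filter.Eventually.of_forall fun ξ => ?_)
    rw [Complex.norm_real, Real.norm_eq_abs, Real.abs_exp]
    exact hexp t ht ξ
  have step : ∀ s ∈ Set.Ioc 0 t, ∫ ξ, A ξ *
      (stableExponent α ν ξ * Real.exp (-stableExponent α ν (s ^ (1 / α) • ξ)) : ℝ) =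
      ∫ ξ, A ξ * (stableExponent α ν ξ * Real.exp (-(s * stableExponent α ν ξ)) : ℝ) := by
    intro s hs
    simp only [stableExponent_rpow_smul hα0 hs.1.le]
  rw [setIntegral_congr_fun measurableSet_Ioc step, integral_integral_swap]
  · have hin : ∀ ξ, ∫ s in Set.Ioc 0 t,
        A ξ * (stableExponent α ν ξ * Real.exp (-(s * stableExponent α ν ξ)) : ℝ) =
        A ξ - A ξ * (Real.exp (-(t * stableExponent α ν ξ)) : ℝ) := by
      intro ξ
      rw [integral_const_mul, integral_complex_ofReal, integral_Ioc_mul_exp_neg_mul _ ht]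
      push_cast
      ring
    simp only [hin]
    rw [integral_sub hAi hAe, Complex.ofReal_sub, hfg, hμ.stableSemigroup_eq hν hα hg hfg]
    simp only [stableExponent_rpow_smul hα0 ht, hA]
  · have h1 : Integrable (fun _ : ℝ => (1 : ℝ)) (volume.restrict (Set.Ioc 0 t)) :=
      integrable_const _
    -- The exchange is dominated through ψ(ξ) ≤ C‖ξ‖^α and ‖ξ‖^α ≤ 1 + ‖ξ‖².
    have h2 : Integrable fun ξ : Rd d => |C| * (‖ξ‖ ^ 0 * ‖g ξ‖ + ‖ξ‖ ^ 2 * ‖g ξ‖) :=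
      ((hgi 0).add (hgi 2)).const_mul _
    have hs0 : ∀ᵐ z : ℝ × Rd d ∂((volume.restrict (Set.Ioc 0 t)).prod volume),
        z.1 ∈ Set.Ioc 0 t :=
      Measure.quasiMeasurePreserving_fst.ae (ae_restrict_mem measurableSet_Ioc)
    refine (h1.mul_prod h2).mono' ?_ ?_
    · unfold Function.uncurry
      refine hAi.aestronglyMeasurable.comp_snd.mul (Measurable.aestronglyMeasurable (by fun_prop))
    · filter_upwards [hs0] with z hz
      have hΨ := stableExponent_nonneg (α := α) (ν := ν) z.2
      simp only [Function.uncurry]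
      rw [norm_mul, hAn, Complex.norm_real, Real.norm_of_nonneg (by positivity)]
      have hz0 := norm_nonneg z.2
      have hp : ‖z.2‖ ^ α ≤ 1 + ‖z.2‖ ^ 2 := by
        rcases le_total ‖z.2‖ 1 with h | h
        · have := Real.rpow_le_one hz0 h hα0.le
          nlinarith
        · have := Real.rpow_le_rpow_of_exponent_le h hα.2.le
          rw [Real.rpow_two] at this
          linarith
      have hΨ2 : stableExponent α ν z.2 ≤ |C| * (1 + ‖z.2‖ ^ 2) := by
        refine (hC z.2).trans ?_
        have h0 : 0 ≤ ‖z.2‖ ^ α := by positivity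
        exact mul_le_mul (le_abs_self C) hp h0 (abs_nonneg _)
      calc ‖g z.2‖ * (stableExponent α ν z.2 * Real.exp (-(z.1 * stableExponent α ν z.2)))
          ≤ ‖g z.2‖ * (|C| * (1 + ‖z.2‖ ^ 2) * 1) := by
            gcongr
            exact hexp _ hz.1.le _
        _ = _ := by ring

/-- With τ = s^(1/α), the inner frequency integral is (ατ)⁻¹ times the pairing of D^{α-1}f(x + τy)
with ∇p(y). Cauchy-Schwarz and ∇p = p (∇p/p) turn this pairing into an integral against μ. -/
theorem IsLebesgueDensity.enorm_stableSemigroup_sub_le (hp : IsLebesgueDensity μ pα)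
    (hμ : IsStableLaw ν μ) (hν : IsNondegenerateSymmetricStable α ν)
    (hα : α ∈ Set.Ioo (1 : ℝ) 2) (hG : Integrable (gradient pα))
    (hf : ContDiff ℝ ∞ f) (hfc : HasCompactSupport f) {t : ℝ} (ht : 0 ≤ t) (x : Rd d) :
    ‖stableSemigroup α μ t f x - f x‖ₑ ≤
      ∫⁻ s in Set.Ioc 0 t, ENNReal.ofReal (s ^ (-(1 / α)) / α) *
        ∫⁻ y, ‖fracGradient ν f (x + s ^ (1 / α) • y)‖ₑ * ‖logDerivative pα y‖ₑ ∂μ := by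
  have hα0 : 0 < α := by linarith [hα.1]
  have hf1 : ContDiff ℝ 1 f := hf.of_le (by exact_mod_cast le_top)
  have hD := hν.toIsStableLevyMeasure.stronglyMeasurable_fracGradient hf1.continuous
  obtain ⟨g, hgc, hgi, hfg⟩ := exists_fourier_representation hf hfc
  have h := hμ.stableSemigroup_sub_eq hν hα hgc.aestronglyMeasurable hgi hfg ht x
  have hn : ‖stableSemigroup α μ t f x - f x‖ₑ =
      ‖((f x - stableSemigroup α μ t f x : ℝ) : ℂ)‖ₑ := by
    rw [← enorm_neg, neg_sub, ← enorm_norm, ← enorm_norm ((_ : ℝ) : ℂ), Complex.norm_real]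
  rw [hn, h]
  refine (enorm_integral_le_lintegral_enorm _).trans (setLIntegral_mono' measurableSet_Ioc ?_)
  intro s hs
  have hs0 : 0 < s := hs.1
  set τ := s ^ (1 / α) with hτ
  have hτ0 : 0 < τ := by positivity
  have hi := hp.integral_inner_fracGradient hμ hν hα hG hf1 hfc hgc.aestronglyMeasurable hgi hfg τ x
  have hne : ((α * τ : ℝ) : ℂ) ≠ 0 := by
    rw [Complex.ofReal_ne_zero]
    positivity
  set J : ℝ := ∫ y, ⟪fracGradient ν f (x + τ • y), gradient pα y⟫ with hJ
  have hK : ∫ ξ, Complex.exp (Complex.I * (⟪x, ξ⟫ : ℝ)) * g ξ *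
      (stableExponent α ν ξ * Real.exp (-stableExponent α ν (τ • ξ)) : ℝ) =
      ((s ^ (-(1 / α)) / α * J : ℝ) : ℂ) := by
    have hc : s ^ (-(1 / α)) / α = (α * τ)⁻¹ := by
      rw [Real.rpow_neg hs0.le, hτ]
      field_simp
    rw [hc, Complex.ofReal_mul, hi, ← mul_assoc, Complex.ofReal_inv, inv_mul_cancel₀ hne, one_mul]
  have hJle : ‖J‖ₑ ≤ ∫⁻ y, ‖fracGradient ν f (x + τ • y)‖ₑ * ‖logDerivative pα y‖ₑ ∂μ := by
    have hm : Measurable fun y : Rd d => x + τ • y := by fun_prop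
    have hHm : Measurable fun y => ‖fracGradient ν f (x + τ • y)‖ₑ * ‖logDerivative pα y‖ₑ :=
      (hD.measurable.comp hm).enorm.mul hp.measurable_logDerivative.enorm
    rw [hp.lintegral_eq hHm]
    refine (enorm_integral_le_lintegral_enorm _).trans (lintegral_mono fun y => ?_)
    have hle : ‖⟪fracGradient ν f (x + τ • y), gradient pα y⟫‖ₑ ≤
        ‖fracGradient ν f (x + τ • y)‖ₑ * ‖gradient pα y‖ₑ := by
      simp only [← ofReal_norm]
      rw [← ENNReal.ofReal_mul (norm_nonneg _)]
      exact ENNReal.ofReal_le_ofReal (norm_inner_le_norm _ _)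
    refine hle.trans_eq ?_
    rw [hp.gradient_eq, enorm_smul, Real.enorm_of_nonneg (hp.nonneg y), mul_left_comm]
  rw [hK, ← enorm_norm, Complex.norm_real, enorm_norm, enorm_mul,
    Real.enorm_of_nonneg (by positivity)]
  gcongr

theorem lintegral_Ioc_rpow_neg_div (hα : 1 < α) {t : ℝ} (ht : 0 < t) :
    ∫⁻ s in Set.Ioc 0 t, ENNReal.ofReal (s ^ (-(1 / α)) / α) =
      ENNReal.ofReal (t ^ (1 - 1 / α) / (α - 1)) := by
  have hlt : 1 / α < 1 := by rw [div_lt_one (by linarith)]; exact hα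
  rw [← ofReal_integral_eq_lintegral_ofReal]
  · rw [← intervalIntegral.integral_of_le ht.le, intervalIntegral.integral_div,
      integral_rpow (Or.inl (by linarith)), Real.zero_rpow (by linarith), sub_zero, div_div,
      neg_add_eq_sub, sub_mul, one_mul, one_div_mul_cancel (by linarith)]
  · have h := (intervalIntegral.intervalIntegrable_rpow' (r := -(1 / α)) (a := 0) (b := t)
      (by linarith)).div_const α
    rwa [intervalIntegrable_iff_integrableOn_Ioc_of_le ht.le] at h
  · filter_upwards [ae_restrict_mem measurableSet_Ioc] with s hs
    have : 0 < s := hs.1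
    have : 0 < α := by linarith
    positivity

/-- Jensen is applied once, to the product of μ with the normalised time weight. The x-integral of
the translated ‖D^{α-1}f‖^q then depends on neither s nor y, so the three factors separate. -/
theorem IsLebesgueDensity.eLpNorm_stableSemigroup_sub_le_fracGradient
    (hp : IsLebesgueDensity μ pα) (hμ : IsStableLaw ν μ)
    (hν : IsNondegenerateSymmetricStable α ν) (hα : α ∈ Set.Ioo (1 : ℝ) 2)
    (hG : Integrable (gradient pα)) {q : ℝ} (hq : 1 ≤ q) {t : ℝ} (ht : 0 < t)
    (hf : ContDiff ℝ ∞ f) (hfc : HasCompactSupport f) :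
    eLpNorm (fun x => stableSemigroup α μ t f x - f x) (ENNReal.ofReal q) volume ≤
      ENNReal.ofReal (t ^ (1 - 1 / α) / (α - 1)) *
        eLpNorm (logDerivative pα) (ENNReal.ofReal q) μ *
        eLpNorm (fracGradient ν f) (ENNReal.ofReal q) volume := by
  have := hμ.isProbabilityMeasure
  have hq0 : 0 < q := by linarith
  have hα1 : 0 < α - 1 := by linarith [hα.1]
  have hD := (hν.toIsStableLevyMeasure.stronglyMeasurable_fracGradient hf.continuous).measurable
  have hL := hp.measurable_logDerivative
  set w : ℝ → ENNReal := fun s => ENNReal.ofReal (s ^ (-(1 / α)) / α) with hw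
  have hwm : Measurable w := by fun_prop
  set W : ENNReal := ENNReal.ofReal (t ^ (1 - 1 / α) / (α - 1)) with hW
  have hW0 : W ≠ 0 := by
    rw [hW, ne_eq, ENNReal.ofReal_eq_zero, not_le]
    positivity
  have hWt : W ≠ ⊤ := ENNReal.ofReal_ne_top
  -- Dividing the weight s^(-1/α)/α by its mass W makes it a probability on (0, t]; W is the time
  -- constant of the estimate.
  set ρ : Measure ℝ := W⁻¹ • (volume.restrict (Set.Ioc 0 t)).withDensity w with hρ
  have hρp : IsProbabilityMeasure ρ := by
    refine ⟨?_⟩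
    rw [hρ, Measure.smul_apply, withDensity_apply _ MeasurableSet.univ, Measure.restrict_univ,
      lintegral_Ioc_rpow_neg_div hα.1 ht, smul_eq_mul, ENNReal.inv_mul_cancel hW0 hWt]
  have hρi : ∀ F : ℝ → ENNReal, Measurable F →
      ∫⁻ s in Set.Ioc 0 t, w s * F s = W * ∫⁻ s, F s ∂ρ := by
    intro F hF
    rw [hρ, lintegral_smul_measure, lintegral_withDensity_eq_lintegral_mul _ hwm hF, smul_eq_mul,
      ← mul_assoc, ENNReal.mul_inv_cancel hW0 hWt, one_mul]
    rfl
  set H : Rd d → ℝ × Rd d → ENNReal := fun x z =>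
    ‖fracGradient ν f (x + z.1 ^ (1 / α) • z.2)‖ₑ * ‖logDerivative pα z.2‖ₑ with hH
  have hHm : Measurable (Function.uncurry H) := by
    have h1 : Measurable fun z : Rd d × (ℝ × Rd d) => z.1 + z.2.1 ^ (1 / α) • z.2.2 := by fun_prop
    have h2 : Measurable fun z : Rd d × (ℝ × Rd d) => z.2.2 := by fun_prop
    exact (hD.comp h1).enorm.mul (hL.comp h2).enorm
  have hpt : ∀ x, ‖stableSemigroup α μ t f x - f x‖ₑ ≤ W * ∫⁻ z, H x z ∂(ρ.prod μ) := by
    intro x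
    have hHx : Measurable (H x) := hHm.of_uncurry_left
    have hF : Measurable fun s => ∫⁻ y, H x (s, y) ∂μ := hHx.lintegral_prod_right'
    have h := hp.enorm_stableSemigroup_sub_le hμ hν hα hG hf hfc ht.le x
    rw [lintegral_prod _ hHx.aemeasurable, ← hρi _ hF]
    exact h
  have key : ∫⁻ x, ‖stableSemigroup α μ t f x - f x‖ₑ ^ q ≤
      W ^ q * (∫⁻ y, ‖logDerivative pα y‖ₑ ^ q ∂μ) * ∫⁻ x, ‖fracGradient ν f x‖ₑ ^ q := by
    calc ∫⁻ x, ‖stableSemigroup α μ t f x - f x‖ₑ ^ q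
        ≤ ∫⁻ x, W ^ q * (∫⁻ z, H x z ∂(ρ.prod μ)) ^ q := lintegral_mono fun x => by
          rw [← ENNReal.mul_rpow_of_nonneg _ _ hq0.le]
          exact ENNReal.rpow_le_rpow (hpt x) hq0.le
      _ = W ^ q * ∫⁻ x, (∫⁻ z, H x z ∂(ρ.prod μ)) ^ q :=
          lintegral_const_mul' _ _ (ENNReal.rpow_ne_top_of_nonneg hq0.le hWt)
      _ ≤ W ^ q * ∫⁻ z, (∫⁻ x, H x z ^ q) ∂(ρ.prod μ) := by
          gcongr
          exact lintegral_rpow_lintegral_le volume _ hq hHm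
      _ = W ^ q * ∫⁻ z, ‖logDerivative pα z.2‖ₑ ^ q * (∫⁻ x, ‖fracGradient ν f x‖ₑ ^ q)
            ∂(ρ.prod μ) := by
          congr 1
          refine lintegral_congr fun z => ?_
          simp only [hH, ENNReal.mul_rpow_of_nonneg _ _ hq0.le,
            mul_comm _ (‖logDerivative _ _‖ₑ ^ q)]
          rw [lintegral_const_mul' _ _ (ENNReal.rpow_ne_top_of_nonneg hq0.le enorm_ne_top),
            lintegral_add_right_eq_self (fun x => ‖fracGradient ν f x‖ₑ ^ q)]
      _ = _ := by
          have hLq : Measurable fun y => ‖logDerivative pα y‖ₑ ^ q := hL.enorm.pow_const q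
          have hLq' : Measurable fun z : ℝ × Rd d => ‖logDerivative pα z.2‖ₑ ^ q :=
            hLq.comp measurable_snd
          rw [lintegral_mul_const _ hLq', mul_assoc, lintegral_prod _ hLq'.aemeasurable]
          simp
  rw [← ENNReal.rpow_le_rpow_iff hq0, ENNReal.mul_rpow_of_nonneg _ _ hq0.le,
    ENNReal.mul_rpow_of_nonneg _ _ hq0.le, eLpNorm_ofReal_rpow _ hq0, eLpNorm_ofReal_rpow _ hq0,
    eLpNorm_ofReal_rpow _ hq0]
  exact key

end StableHeat

theorem mainTheorem2 {d : ℕ} (hd : 1 ≤ d) {α : ℝ} (hα : α ∈ Set.Ioo (1 : ℝ) 2)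
    (ν μ : Measure (StableHeat.Rd d)) (pα : StableHeat.Rd d → ℝ)
    (hν : StableHeat.IsNondegenerateSymmetricStable α ν)
    (hμ : StableHeat.IsStableLaw ν μ)
    (hpα : StableHeat.IsLebesgueDensity μ pα)
    (hlog : ∀ p : ℝ, 1 ≤ p →
      eLpNorm (StableHeat.logDerivative pα) (ENNReal.ofReal p) μ < ⊤)
    {Ω : Type*} [MeasurableSpace Ω] :
    (∀ p : ℝ, 1 ≤ p → ∀ t : ℝ, 0 < t → ∀ f : StableHeat.Rd d → ℝ,
      ContDiff ℝ ∞ f → HasCompactSupport f →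
      eLpNorm (fun x => StableHeat.stableSemigroup α μ t f x - f x) (ENNReal.ofReal p) volume ≤
        ENNReal.ofReal (t ^ (1 - 1 / α) / (α - 1)) *
          eLpNorm (StableHeat.logDerivative pα) (ENNReal.ofReal p) μ *
          eLpNorm (StableHeat.fracGradient ν f) (ENNReal.ofReal p) volume) ∧
    (∀ (P : Measure Ω) [IsProbabilityMeasure P] (Y : Ω → ℝ), AEMeasurable Y P →
      (∀ ξ : ℝ, ∫ w, Complex.exp (Complex.I * ((ξ * Y w : ℝ) : ℂ)) ∂P =
        ((Real.exp (-(|ξ| ^ α)) : ℝ) : ℂ)) →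
      ∀ p : ℝ, 1 ≤ p → p < α → ∀ t : ℝ, 0 < t → ∀ f : StableHeat.Rd d → ℝ,
      ContDiff ℝ ∞ f → HasCompactSupport f →
      eLpNorm (fun x => StableHeat.stableSemigroup α μ t f x - f x) (ENNReal.ofReal p) volume ≤
        ENNReal.ofReal (t ^ (1 / α)) *
          (∫⁻ w, ENNReal.ofReal (|Y w| ^ p) ∂P) ^ (1 / p) *
          eLpNorm (fun x => StableHeat.sigmaNorm α ν (gradient f x))
            (ENNReal.ofReal p) volume) := by
  have hlog1 : eLpNorm (StableHeat.logDerivative pα) 1 μ < ⊤ := by simpa using hlog 1 le_rfl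
  refine ⟨fun p hp t ht f hf hfc => ?_, fun P _ Y hY hYc p hp _ t ht f hf hfc => ?_⟩
  · exact hpα.eLpNorm_stableSemigroup_sub_le_fracGradient hμ hν hα
      (hpα.integrable_gradient hlog1) hp ht hf hfc
  · exact hμ.eLpNorm_stableSemigroup_sub_le_sigmaNorm hν hα P hY hYc hp ht
      (hf.of_le (by exact_mod_cast le_top)) hfc
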